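/- Names (concept names $A$, role names $p,r,s,t$, individuals $a,b$) come from three countably infinite sets. A role is a role name $p$ or an inverse $p^-$. Fix a set $\mathsf{N}_{R_s}$ of roles closed under inverses (the simple roles). TBoxes are finite sets of axioms in normal form $A\sqsubseteq A'$, $A\sqsubseteq\exists p$, $\exists p\sqsubseteq A$, $p\sqsubseteq s$, $p\sqsubseteq s^-$, $\mathbf{disj}(A,A')$, $\mathbf{disj}(p,p')$ and complex role inclusions (CRIs) $r\cdot s\sqsubseteq t$; ABoxes are finite sets of assertions $A(a)$, $p(a,b)$. A TBox $\mathcal T$ is a $\textit{DL-Lite}^{\mathcal{HR}}$ TBox if for each CRI $r\cdot s\sqsubseteq t\in\mathcal T$ the role $s$ is simple and $t$ is not, and for each role inclusion in $\mathcal T$ with simple right-hand side the left-hand side is simple. Its recursion graph has a node for each concept and role name and, for each axiom among $A\sqsubseteq A'$, $A\sqsubseteq\exists r$, $\exists r\sqsubseteq A$, $t\sqsubseteq r$, $t\sqsubseteq r^-$, $r\cdot s\sqsubseteq t$, an edge from the name on the right-hand side to each name on the left-hand side. $\mathcal T$ is recursion safe if moreover for each CRI $r_1\cdot s\sqsubseteq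 r_2\in\mathcal T$: (a) if $r_2$ participates in a cycle of the recursion graph, the cycle has length at most one and $r_1=r_2$; (b) there is no axiom $A\sqsubseteq\exists t\in\mathcal T$ such that $(t,s)$ or $(t,s^-)$ is in the reflexive transitive closure of the role inclusions of $\mathcal T$ with simple right-hand side. The small model $\mathcal U_{\mathcal T,\mathcal A}$ of $(\mathcal T,\mathcal A)$ has as domain the individuals $a$ occurring in $\mathcal A$ and, for each role name $r$ such that some $A\sqsubseteq\exists r$ is in $\mathcal T$, fresh elements $c_r$ and $c_{ar}$. Concept and role names have the least extensions that contain $\mathcal A$, are closed under the inclusions $A\sqsubseteq A'$, $\exists p\sqsubseteq A$, $p\sqsubseteq s$, $p\sqsubseteq s^-$ and the CRIs of $\mathcal T$, and satisfy for each $A\sqsubseteq\exists r\in\mathcal T$: $(a,c_{ar})\in r$ for each individual $a\in A$, and $(d,c_r)\in r$ for each other element $d\in A$. An order constraint $ord(s,\mathbf A,\prec)$ consists of a simple role $s$, a finite set $\mathbf A$ of concept names and a strict partial order $\prec$ over $\mathbf A$. An interpretation $\mathcal I$ satisfies it if $$s^{\mathcal I}\subseteq\bigcup_{A_1,A_2\in\mathbf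 A}A_1^{\mathcal I}\times A_2^{\mathcal I}\quad\text{and}\quad s^{\mathcal I}\cap\bigcup_{A_1,A_2\in\mathbf A,\;A_1\not\prec A_2}A_1^{\mathcal I}\times A_2^{\mathcal I}=\emptyset.$$ For a finite set $\mathcal C$ of order constraints, $(\mathcal T,\mathcal A)$ is $\mathcal C$-admissible if $\mathcal U_{\mathcal T,\mathcal A}$ satisfies every constraint in $\mathcal C$. **Proposition.** (1) For every recursion safe $\textit{DL-Lite}^{\mathcal{HR}}$ KB $(\mathcal T,\mathcal A)$ and finite set $\mathcal C$ of order constraints, the following check returns true if and only if $(\mathcal T,\mathcal A)$ is $\mathcal C$-admissible: for each $ord(s,\mathbf A,\prec)\in\mathcal C$ evaluate over $\mathcal U_{\mathcal T,\mathcal A}$ the queries $q_1(x,y)\leftarrow s(x,y)$, $q_2(x,y)\leftarrow\bigvee_{A_1\prec A_2}A_1(x),s(x,y),A_2(y)$ and $q_3(x,y)\leftarrow\bigvee_{A_1\not\prec A_2}A_1(x),s(x,y),A_2(y)$ (with $A_1,A_2\in\mathbf A$), return false if the answers of $q_1$ are not all answers of $q_2$, or if $q_1$ and $q_3$ have a common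 answer; if no constraint returns false, return true. (2) Deciding, given a recursion safe $\textit{DL-Lite}^{\mathcal{HR}}$ KB $(\mathcal T,\mathcal A)$ and a finite set $\mathcal C$ of order constraints, whether $(\mathcal T,\mathcal A)$ is $\mathcal C$-admissible is feasible in polynomial time in combined complexity: some Turing machine decides it in time polynomial in the length of the string that lists $\mathcal T$, $\mathcal A$ and $\mathcal C$, with names written in binary. -/

import Mathlib

namespace DLLite

/-! ### Syntax: names, roles, axioms in normal form, assertions -/

/-- The countably infinite sets of concept, role and individual names. -/
abbrev ConceptName := ℕ
abbrev RoleName := ℕ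
abbrev IndName := ℕ

/-- Roles: role names `p` and inverse roles `p⁻`. -/
inductive Role where
  | name (p : RoleName)
  | inv (p : RoleName)
  deriving DecidableEq

/-- The inverse of a role. -/
def Role.inverse : Role → Role
  | .name p => .inv p
  | .inv p => .name p

/-- TBox axioms in normal form. -/
inductive TAxiom where
  /-- `A ⊑ A'` -/
  | subConcept (A A' : ConceptName)
  /-- `A ⊑ ∃ p` -/
  | subExists (A : ConceptName) (p : RoleName)
  /-- `∃ p ⊑ A` -/
  | existsSub (p : RoleName) (A : ConceptName)
  /-- `p ⊑ s` -/
  | subRole (p s : RoleName)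
  /-- `p ⊑ s⁻` -/
  | subInverse (p s : RoleName)
  /-- `disj(A, A')` -/
  | disjConcept (A A' : ConceptName)
  /-- `disj(p, p')` -/
  | disjRole (p p' : RoleName)
  /-- the complex role inclusion `r · s ⊑ t` -/
  | cri (r s t : RoleName)
  deriving DecidableEq

/-- ABox assertions `A(a)` and `p(a, b)`. -/
inductive Assertion where
  | concept (A : ConceptName) (a : IndName)
  | role (p : RoleName) (a b : IndName)
  deriving DecidableEq

/-- Finite sets of axioms and of assertions, presented as lists. -/
abbrev TBox := List TAxiom
abbrev ABox := List Assertion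

/-- The individuals that occur in an assertion. -/
def Assertion.inds : Assertion → Set IndName
  | .concept _ a => {a}
  | .role _ a b => {a, b}

/-- `ind(𝒜)`, the individuals that occur in the ABox. -/
def ABox.inds (𝒜 : ABox) : Set IndName := {a | ∃ α ∈ 𝒜, a ∈ α.inds}

/-! ### DL-Lite^HR and recursion safety, relative to a set `NRs` of simple roles -/

/-- The two conditions on the TBoxes of DL-Lite^HR. -/
structure IsDLLiteHR (NRs : Set Role) (𝒯 : TBox) : Prop where
  cri : ∀ r s t, TAxiom.cri r s t ∈ 𝒯 → Role.name s ∈ NRs ∧ Role.name t ∉ NRs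
  subRole : ∀ p s, TAxiom.subRole p s ∈ 𝒯 → Role.name s ∈ NRs → Role.name p ∈ NRs
  subInverse : ∀ p s, TAxiom.subInverse p s ∈ 𝒯 → Role.inv s ∈ NRs → Role.name p ∈ NRs

/-- Nodes `v_A` and `v_r` of the recursion graph. -/
inductive Node where
  | concept (A : ConceptName)
  | role (r : RoleName)

/-- The edges of the recursion graph of `𝒯`. -/
inductive RecEdge (𝒯 : TBox) : Node → Node → Prop
  | subConcept {A₁ A₂} : TAxiom.subConcept A₁ A₂ ∈ 𝒯 → RecEdge 𝒯 (.concept A₂) (.concept A₁)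
  | subRole {t r} : TAxiom.subRole t r ∈ 𝒯 → RecEdge 𝒯 (.role r) (.role t)
  | subInverse {r p} : TAxiom.subInverse r p ∈ 𝒯 → RecEdge 𝒯 (.role p) (.role r)
  | subExists {A r} : TAxiom.subExists A r ∈ 𝒯 → RecEdge 𝒯 (.role r) (.concept A)
  | existsSub {r A} : TAxiom.existsSub r A ∈ 𝒯 → RecEdge 𝒯 (.concept A) (.role r)
  | criLeft {r s t} : TAxiom.cri r s t ∈ 𝒯 → RecEdge 𝒯 (.role t) (.role r)
  | criRight {r s t} : TAxiom.cri r s t ∈ 𝒯 → RecEdge 𝒯 (.role t) (.role s)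

/-- There is a nonempty directed path from `v` to `w` in the recursion graph. In particular,
`v` participates in a cycle iff `RecPath 𝒯 v v`, and in a cycle of length at least two iff
`RecPath 𝒯 v w` and `RecPath 𝒯 w v` for some `w ≠ v`. -/
def RecPath (𝒯 : TBox) : Node → Node → Prop := Relation.TransGen (RecEdge 𝒯)

/-- Simple role inclusions of `𝒯`: those whose right-hand side is a simple role. -/
inductive SimpleIncl (NRs : Set Role) (𝒯 : TBox) : Role → Role → Prop
  | subRole {p s} : TAxiom.subRole p s ∈ 𝒯 → Role.name s ∈ NRs →
      SimpleIncl NRs 𝒯 (.name p) (.name s)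
  | subInverse {p s} : TAxiom.subInverse p s ∈ 𝒯 → Role.inv s ∈ NRs →
      SimpleIncl NRs 𝒯 (.name p) (.inv s)

/-- `⊑ˢ_𝒯`, the reflexive and transitive closure of the simple inclusions. -/
def SimpleSub (NRs : Set Role) (𝒯 : TBox) : Role → Role → Prop :=
  Relation.ReflTransGen (SimpleIncl NRs 𝒯)

/-- Recursion safe DL-Lite^HR TBoxes. -/
structure IsRecursionSafe (NRs : Set Role) (𝒯 : TBox) : Prop where
  isDLLiteHR : IsDLLiteHR NRs 𝒯
  /-- Every cycle through `r₂` has length at most one. -/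
  cycle_length : ∀ r₁ s r₂, TAxiom.cri r₁ s r₂ ∈ 𝒯 →
    ∀ w, RecPath 𝒯 (.role r₂) w → RecPath 𝒯 w (.role r₂) → w = .role r₂
  /-- If `r₂` participates in a cycle, then `r₁ = r₂`. -/
  cycle_eq : ∀ r₁ s r₂, TAxiom.cri r₁ s r₂ ∈ 𝒯 → RecPath 𝒯 (.role r₂) (.role r₂) → r₁ = r₂
  /-- The simple role that guards a CRI is not existentially implied. -/
  guard : ∀ r₁ s r₂, TAxiom.cri r₁ s r₂ ∈ 𝒯 → ∀ A t, TAxiom.subExists A t ∈ 𝒯 →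
    ¬ SimpleSub NRs 𝒯 (.name t) (.name s) ∧ ¬ SimpleSub NRs 𝒯 (.name t) (.inv s)

/-! ### Interpretations and order constraints -/

/-- Interpretations of the concept and role names over a domain `Δ`. -/
structure Interpretation where
  Δ : Type
  concept : ConceptName → Set Δ
  role : RoleName → Set (Δ × Δ)

/-- The extension of a role, with `(p⁻)^ℐ = {(d, d') | (d', d) ∈ p^ℐ}`. -/
def Interpretation.roleExt (ℐ : Interpretation) : Role → Set (ℐ.Δ × ℐ.Δ)
  | .name p => ℐ.role p
  | .inv p => {x | (x.2, x.1) ∈ ℐ.role p}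

/-- The data of an order constraint `ord(s, 𝐀, ≺)`; the finite set `𝐀` and the finite
relation `≺` are listed. -/
structure OrderConstraint where
  role : Role
  concepts : List ConceptName
  prec : List (ConceptName × ConceptName)

/-- `s` is a simple role, and `≺` is a strict partial order over `𝐀`. -/
structure OrderConstraint.WellFormed (NRs : Set Role) (c : OrderConstraint) : Prop where
  simple : c.role ∈ NRs
  subset : ∀ A B, (A, B) ∈ c.prec → A ∈ c.concepts ∧ B ∈ c.concepts
  irrefl : ∀ A, (A, A) ∉ c.prec
  trans : ∀ A B D, (A, B) ∈ c.prec → (B, D) ∈ c.prec → (A, D) ∈ c.prec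

/-- `ℐ` satisfies `ord(s, 𝐀, ≺)`. -/
def Interpretation.SatisfiesOrder (ℐ : Interpretation) (c : OrderConstraint) : Prop :=
  (ℐ.roleExt c.role ⊆
    ⋃ A₁ ∈ c.concepts, ⋃ A₂ ∈ c.concepts, ℐ.concept A₁ ×ˢ ℐ.concept A₂) ∧
  (ℐ.roleExt c.role ∩
    ⋃ A₁ ∈ c.concepts, ⋃ A₂ ∈ c.concepts, ⋃ (_ : (A₁, A₂) ∉ c.prec),
      ℐ.concept A₁ ×ˢ ℐ.concept A₂) = ∅

/-! ### The small model of a knowledge base -/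

/-- Individuals `a`, fillers `c_{ar}` and shared fillers `c_r`. -/
inductive Elem where
  | ind (a : IndName)
  | filler (a : IndName) (r : RoleName)
  | shared (r : RoleName)
  deriving DecidableEq

/-- `r` occurs on the right-hand side of a concept inclusion of `𝒯`. -/
def OccursRhs (𝒯 : TBox) (r : RoleName) : Prop := ∃ A, TAxiom.subExists A r ∈ 𝒯

/-- The domain `D₀ ∪ D₁ ∪ D₂`. -/
def smallDomain (𝒯 : TBox) (𝒜 : ABox) : Set Elem := fun e =>
  match e with
  | .ind a => a ∈ 𝒜.inds
  | .filler a r => a ∈ 𝒜.inds ∧ OccursRhs 𝒯 r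
  | .shared r => OccursRhs 𝒯 r

/-- Statements `d ∈ A^ℐ` and `(d, e) ∈ r^ℐ`. -/
inductive Fact where
  | concept (A : ConceptName) (d : Elem)
  | role (r : RoleName) (d e : Elem)
  deriving DecidableEq

/-- The least set of facts closed under the conditions on the small model; by construction it
only speaks about elements of `smallDomain 𝒯 𝒜`. -/
inductive SmallFact (𝒯 : TBox) (𝒜 : ABox) : Fact → Prop
  | aboxConcept {A a} : Assertion.concept A a ∈ 𝒜 → SmallFact 𝒯 𝒜 (.concept A (.ind a))
  | aboxRole {p a b} : Assertion.role p a b ∈ 𝒜 → SmallFact 𝒯 𝒜 (.role p (.ind a) (.ind b))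
  | existsInd {B r a} : TAxiom.subExists B r ∈ 𝒯 → SmallFact 𝒯 𝒜 (.concept B (.ind a)) →
      SmallFact 𝒯 𝒜 (.role r (.ind a) (.filler a r))
  | existsFiller {B r a p} : TAxiom.subExists B r ∈ 𝒯 →
      SmallFact 𝒯 𝒜 (.concept B (.filler a p)) →
      SmallFact 𝒯 𝒜 (.role r (.filler a p) (.shared r))
  | existsShared {B r p} : TAxiom.subExists B r ∈ 𝒯 → SmallFact 𝒯 𝒜 (.concept B (.shared p)) →
      SmallFact 𝒯 𝒜 (.role r (.shared p) (.shared r))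
  | subConcept {A A' d} : TAxiom.subConcept A A' ∈ 𝒯 → SmallFact 𝒯 𝒜 (.concept A d) →
      SmallFact 𝒯 𝒜 (.concept A' d)
  | existsSub {p A d e} : TAxiom.existsSub p A ∈ 𝒯 → SmallFact 𝒯 𝒜 (.role p d e) →
      SmallFact 𝒯 𝒜 (.concept A d)
  | subRole {p s d e} : TAxiom.subRole p s ∈ 𝒯 → SmallFact 𝒯 𝒜 (.role p d e) →
      SmallFact 𝒯 𝒜 (.role s d e)
  | subInverse {p s d e} : TAxiom.subInverse p s ∈ 𝒯 → SmallFact 𝒯 𝒜 (.role p d e) →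
      SmallFact 𝒯 𝒜 (.role s e d)
  | cri {r s t d e f} : TAxiom.cri r s t ∈ 𝒯 → SmallFact 𝒯 𝒜 (.role r d e) →
      SmallFact 𝒯 𝒜 (.role s e f) → SmallFact 𝒯 𝒜 (.role t d f)

/-- The small model of `(𝒯, 𝒜)`. -/
def smallModel (𝒯 : TBox) (𝒜 : ABox) : Interpretation where
  Δ := smallDomain 𝒯 𝒜
  concept A := {d | SmallFact 𝒯 𝒜 (.concept A d.1)}
  role r := {x | SmallFact 𝒯 𝒜 (.role r x.1.1 x.2.1)}

/-- `(𝒯, 𝒜)` is `𝒞`-admissible: its small model satisfies all order constraints in `𝒞`. -/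
def CAdmissible (𝒯 : TBox) (𝒜 : ABox) (𝒞 : List OrderConstraint) : Prop :=
  ∀ c ∈ 𝒞, (smallModel 𝒯 𝒜).SatisfiesOrder c

/-! ### Queries and the admissibility check -/

/-- Query atoms `A(x)` and `p(x, y)`; variables are natural numbers. -/
inductive Atom where
  | concept (A : ConceptName) (x : ℕ)
  | role (p : RoleName) (x y : ℕ)

/-- The atom `s(x, y)` for a role `s`, where `p⁻(x, y)` stands for `p(y, x)`. -/
def Role.atom : Role → ℕ → ℕ → Atom
  | .name p, x, y => .role p x y
  | .inv p, x, y => .role p y x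

/-- Conjunctive queries of arity `n` (without constants and equalities); the variables that are
not answer variables are existentially quantified. -/
structure CQ (n : ℕ) where
  answer : Fin n → ℕ
  body : List Atom

/-- `π` maps the atom into `ℐ`. -/
def Interpretation.SatisfiesAtom (ℐ : Interpretation) (π : ℕ → ℐ.Δ) : Atom → Prop
  | .concept A x => π x ∈ ℐ.concept A
  | .role p x y => (π x, π y) ∈ ℐ.role p

/-- `ans(q, ℐ)` for a conjunctive query. -/
def CQ.ans {n : ℕ} (q : CQ n) (ℐ : Interpretation) : Set (Fin n → ℐ.Δ) :=
  {a | ∃ π : ℕ → ℐ.Δ, (∀ i, π (q.answer i) = a i) ∧ ∀ α ∈ q.body, ℐ.SatisfiesAtom π α}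

/-- `ans(q, ℐ)` for a union of conjunctive queries. -/
def ansUnion {n : ℕ} (Q : List (CQ n)) (ℐ : Interpretation) : Set (Fin n → ℐ.Δ) :=
  ⋃ q ∈ Q, q.ans ℐ

/-- `q(x, y) ← s(x, y)`. -/
def query₁ (c : OrderConstraint) : CQ 2 := ⟨fun i => i, [c.role.atom 0 1]⟩

/-- `q(x, y) ← A₁(x), s(x, y), A₂(y)`. -/
def pairQuery (c : OrderConstraint) (P : ConceptName × ConceptName) : CQ 2 :=
  ⟨fun i => i, [.concept P.1 0, c.role.atom 0 1, .concept P.2 1]⟩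

/-- `q(x, y) ← ⋁_{A₁ ≺ A₂} A₁(x), s(x, y), A₂(y)`. -/
def query₂ (c : OrderConstraint) : List (CQ 2) :=
  ((c.concepts.product c.concepts).filter (· ∈ c.prec)).map (pairQuery c)

/-- `q(x, y) ← ⋁_{A₁ ⊀ A₂} A₁(x), s(x, y), A₂(y)`. -/
def query₃ (c : OrderConstraint) : List (CQ 2) :=
  ((c.concepts.product c.concepts).filter (· ∉ c.prec)).map (pairQuery c)

open Classical in
/-- The admissibility check: evaluate the three queries of each order constraint over `ℐ`. -/
noncomputable def checkAdmissibility (ℐ : Interpretation) : List OrderConstraint → Bool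
  | [] => true
  | c :: 𝒞 =>
    if ¬ (query₁ c).ans ℐ ⊆ ansUnion (query₂ c) ℐ then false
    else if (query₁ c).ans ℐ ∩ ansUnion (query₃ c) ℐ ≠ ∅ then false
    else checkAdmissibility ℐ 𝒞

/-! ### Inputs of the decision problem as strings -/

/-- The input of the problem: a TBox, an ABox, and order constraints. -/
structure Input where
  tbox : TBox
  abox : ABox
  constraints : List OrderConstraint

/-- The KB is a recursion safe DL-Lite^HR KB, and the order constraints are well-formed. -/
structure Input.Valid (NRs : Set Role) (I : Input) : Prop where
  recursionSafe : IsRecursionSafe NRs I.tbox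
  wellFormed : ∀ c ∈ I.constraints, c.WellFormed NRs

/-- The input alphabet: binary digits, a symbol `arg` in front of each name, and one keyword for
each kind of axiom, assertion, and component of an order constraint. -/
inductive Sym where
  | bit (b : Bool)
  | arg
  | subConcept | subExists | existsSub | subRole | subInverse | disjConcept | disjRole | cri
  | assertConcept | assertRole
  | ordName | ordInv | ordMember | ordPrec
  deriving DecidableEq, Fintype

/-- A name is written in binary, after the symbol `arg`. -/
def encodeName (n : ℕ) : List Sym := .arg :: (Computability.encodeNat n).map .bit

def encodeAxiom : TAxiom → List Sym
  | .subConcept A A' => .subConcept :: (encodeName A ++ encodeName A')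
  | .subExists A p => .subExists :: (encodeName A ++ encodeName p)
  | .existsSub p A => .existsSub :: (encodeName p ++ encodeName A)
  | .subRole p s => .subRole :: (encodeName p ++ encodeName s)
  | .subInverse p s => .subInverse :: (encodeName p ++ encodeName s)
  | .disjConcept A A' => .disjConcept :: (encodeName A ++ encodeName A')
  | .disjRole p p' => .disjRole :: (encodeName p ++ encodeName p')
  | .cri r s t => .cri :: (encodeName r ++ encodeName s ++ encodeName t)

def encodeAssertion : Assertion → List Sym
  | .concept A a => .assertConcept :: (encodeName A ++ encodeName a)
  | .role p a b => .assertRole :: (encodeName p ++ encodeName a ++ encodeName b)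

def encodeRole : Role → List Sym
  | .name p => .ordName :: encodeName p
  | .inv p => .ordInv :: encodeName p

def encodeConstraint (c : OrderConstraint) : List Sym :=
  encodeRole c.role ++
    c.concepts.flatMap (fun A => .ordMember :: encodeName A) ++
    c.prec.flatMap (fun P => .ordPrec :: (encodeName P.1 ++ encodeName P.2))

/-- The string that presents the input: all axioms, then all assertions, then all order
constraints. -/
def encodeInput (I : Input) : List Sym :=
  I.tbox.flatMap encodeAxiom ++ I.abox.flatMap encodeAssertion ++
    I.constraints.flatMap encodeConstraint

end DLLite

/-! Correctness of the query check is a pointwise matter and holds in every interpretation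
(`queries_iff_satisfiesOrder`). If no `s`-pair is an answer of the third query, then any two listed
concepts that contain the ends of an `s`-pair are related by `≺`. Hence requiring the pair to be an
answer of the second query is the same as requiring both ends to lie in listed concepts.

For the complexity bound, let `n` be the number of occurrences of names in the input. Every element
of the small model is an individual, a shared filler, or a filler given by two names, so there are
`O(n²)` candidate elements and `O(n⁵)` candidate facts. The facts of the model are the least fixed
point of a monotone one-step derivability operator. Starting from the empty set, each round that is
not yet stable adds a candidate, so as many rounds as there are candidates suffice
(`filter_iterate_stable`, `mem_saturate_iff`). Once the facts are listed, each order constraint is a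
finite search.

To get an actual Turing machine, programs are written in a small structured language over Boolean
stacks, which compiles to `TM2` machines with one machine step per program step (`Run.reach`). Data
are binary trees, stored by their self-delimiting preorder codes. The predicate `Poly` singles out
the functions computed by such programs in polynomial time. It is closed under composition, pairing,
branching, projections, equality tests and those list folds whose intermediate accumulators have
polynomial size (`Poly.foldl`). The decision procedure is assembled from these operations.
`nonempty_computableInPolyTime` turns it into a machine, and `decideAdmissible_encodeInput` states
its correctness. It works on the reversed input string because reading symbols from one stack and
pushing their codes onto another reverses their order. -/

/-! ### A structured language of programs over Boolean stacks -/

namespace StackProgram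

open Turing Function

/-- The contents of the stacks, indexed by natural numbers. -/
abbrev Store := ℕ → List Bool

/-- Structured programs over Boolean stacks. `pop` branches on the popped symbol, and `loop` pops
symbols from a stack until the stack is empty, and runs one of two bodies after each pop. -/
inductive Prog where
  | skip
  | push (k : ℕ) (b : Bool)
  | pop (k : ℕ) (pn pt pf : Prog)
  | seq (p q : Prog)
  | loop (k : ℕ) (pt pf : Prog)

/-- `Run p S S' t`: the program `p` transforms `S` into `S'` within `t` steps. -/
inductive Run : Prog → Store → Store → ℕ → Prop
  | skip {S} : Run .skip S S 1
  | push {k b S} : Run (.push k b) S (update S k (b :: S k)) 1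
  | pop_nil {k pn pt pf S S' t} : S k = [] → Run pn S S' t → Run (.pop k pn pt pf) S S' (t + 1)
  | pop_true {k pn pt pf S S' t w} : S k = true :: w → Run pt (update S k w) S' t →
      Run (.pop k pn pt pf) S S' (t + 1)
  | pop_false {k pn pt pf S S' t w} : S k = false :: w → Run pf (update S k w) S' t →
      Run (.pop k pn pt pf) S S' (t + 1)
  | seq {p q S S₁ S₂ t₁ t₂} : Run p S S₁ t₁ → Run q S₁ S₂ t₂ → Run (.seq p q) S S₂ (t₁ + t₂)
  | loop_nil {k pt pf S} : S k = [] → Run (.loop k pt pf) S S 1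
  | loop_true {k pt pf S S₁ S₂ t₁ t₂ w} : S k = true :: w → Run pt (update S k w) S₁ t₁ →
      Run (.loop k pt pf) S₁ S₂ t₂ → Run (.loop k pt pf) S S₂ (t₁ + t₂ + 1)
  | loop_false {k pt pf S S₁ S₂ t₁ t₂ w} : S k = false :: w → Run pf (update S k w) S₁ t₁ →
      Run (.loop k pt pf) S₁ S₂ t₂ → Run (.loop k pt pf) S S₂ (t₁ + t₂ + 1)
  | mono {p S S' t t'} : Run p S S' t → t ≤ t' → Run p S S' t'

/-- Stacks grow by at most one symbol in each step. -/
theorem Run.length_le {p S S' t} (h : Run p S S' t) (k : ℕ) :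
    (S' k).length ≤ (S k).length + t := by
  have key : ∀ (S : Store) (i : ℕ) (b : Bool) (w : List Bool), S i = b :: w →
      (update S i w k).length ≤ (S k).length := by
    intro S i b w hS
    by_cases hk : k = i
    · subst hk; simp [hS]
    · simp [update_of_ne hk]
  induction h with
  | skip => simp
  | @push i b S =>
    by_cases hk : k = i
    · subst hk; simp
    · simp [update_of_ne hk]
  | pop_nil _ _ ih => omega
  | pop_true hS _ ih => have := key _ _ _ _ hS; omega
  | pop_false hS _ ih => have := key _ _ _ _ hS; omega
  | seq _ _ ih₁ ih₂ => omega
  | loop_nil => simp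
  | loop_true hS _ _ ih₁ ih₂ => have := key _ _ _ _ hS; omega
  | loop_false hS _ _ ih₁ ih₂ => have := key _ _ _ _ hS; omega
  | mono _ hle ih => omega

/-- All stacks of the program have index at most `n`. -/
def Prog.Bounded (n : ℕ) : Prog → Prop
  | skip => True
  | push k _ => k ≤ n
  | pop k pn pt pf => k ≤ n ∧ pn.Bounded n ∧ pt.Bounded n ∧ pf.Bounded n
  | seq p q => p.Bounded n ∧ q.Bounded n
  | loop k pt pf => k ≤ n ∧ pt.Bounded n ∧ pf.Bounded n

theorem Prog.Bounded.mono {n m : ℕ} (h : n ≤ m) {p : Prog} (hp : p.Bounded n) : p.Bounded m := by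
  induction p with
  | skip => trivial
  | push k b => exact le_trans hp h
  | pop k pn pt pf ih₁ ih₂ ih₃ =>
    exact ⟨hp.1.trans h, ih₁ hp.2.1, ih₂ hp.2.2.1, ih₃ hp.2.2.2⟩
  | seq p q ih₁ ih₂ => exact ⟨ih₁ hp.1, ih₂ hp.2⟩
  | loop k pt pf ih₁ ih₂ => exact ⟨hp.1.trans h, ih₁ hp.2.1, ih₂ hp.2.2⟩

/-- Programs name stacks by arbitrary numbers, while a machine has a fixed finite set of stacks;
this bound fixes that set. -/
theorem Prog.exists_bounded (p : Prog) : ∃ n, p.Bounded n := by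
  induction p with
  | skip => exact ⟨0, trivial⟩
  | push k b => exact ⟨k, le_rfl⟩
  | pop k pn pt pf ih₁ ih₂ ih₃ =>
    obtain ⟨a, ha⟩ := ih₁
    obtain ⟨b, hb⟩ := ih₂
    obtain ⟨c, hc⟩ := ih₃
    exact ⟨k + a + b + c, by omega, ha.mono (by omega), hb.mono (by omega), hc.mono (by omega)⟩
  | seq p q ih₁ ih₂ =>
    obtain ⟨a, ha⟩ := ih₁
    obtain ⟨b, hb⟩ := ih₂
    exact ⟨a + b, ha.mono (by omega), hb.mono (by omega)⟩
  | loop k pt pf ih₁ ih₂ =>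
    obtain ⟨a, ha⟩ := ih₁
    obtain ⟨b, hb⟩ := ih₂
    exact ⟨k + a + b, by omega, ha.mono (by omega), hb.mono (by omega)⟩

/-! ### Compilation to Turing machines -/

/-- The control points of a program. -/
def Label : Prog → Type
  | .skip => Unit
  | .push _ _ => Unit
  -- In `pop` and `loop`, the point `none` is the pop itself.
  | .pop _ pn pt pf => Option (Label pn ⊕ Label pt ⊕ Label pf)
  | .seq p q => Label p ⊕ Label q
  | .loop _ pt pf => Option (Label pt ⊕ Label pf)

/-- A program has finitely many control points. -/
@[reducible] def labelFintype : (p : Prog) → Fintype (Label p)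
  | .skip => inferInstanceAs (Fintype Unit)
  | .push _ _ => inferInstanceAs (Fintype Unit)
  | .pop _ pn pt pf =>
    letI := labelFintype pn
    letI := labelFintype pt
    letI := labelFintype pf
    inferInstanceAs (Fintype (Option (Label pn ⊕ Label pt ⊕ Label pf)))
  | .seq p q =>
    letI := labelFintype p
    letI := labelFintype q
    inferInstanceAs (Fintype (Label p ⊕ Label q))
  | .loop _ pt pf =>
    letI := labelFintype pt
    letI := labelFintype pf
    inferInstanceAs (Fintype (Option (Label pt ⊕ Label pf)))

/-- The control point at which a program starts. -/
def entry : (p : Prog) → Label p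
  | .skip => ()
  | .push _ _ => ()
  | .pop _ _ _ _ => none
  | .seq p _ => .inl (entry p)
  | .loop _ _ _ => none

section Compile

variable (A : Type) (n : ℕ)

/-- The machine has an input stack `none` over `A`, and the Boolean stacks `0, …, n`. -/
abbrev StackIdx := Option (Fin (n + 1))

/-- The stack alphabets. -/
def Alphabet (k : StackIdx n) : Type := k.elim A fun _ => Bool

/-- The registers hold a popped input symbol and a popped Boolean. -/
abbrev Register := Option A × Option Bool

variable {A}

/-- The machine statements of a program, in a machine with labels `L` into which the control
points of the program are embedded, and with a label at which to continue. -/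
def code {L : Type} : (p : Prog) → (Label p → L) → L → Label p →
    TM2.Stmt (Alphabet A n) L (Register A)
  | .skip, _, ex, _ => .goto fun _ => ex
  | .push k b, _, ex, _ => .push (some (Fin.ofNat (n + 1) k)) (fun _ => b) (.goto fun _ => ex)
  | .pop k pn pt pf, emb, ex, l => match l with
    | none => .pop (some (Fin.ofNat (n + 1) k)) (fun _ o => (none, o)) <|
        -- Every control point is entered with registers `(none, none)`: popping an empty stack
        -- leaves them so, and the other two branches reset them.
        .branch (fun v => v.2 == none) (.goto fun _ => emb (some (.inl (entry pn)))) <|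
        .branch (fun v => v.2 == some true)
          (.load (fun _ => (none, none)) (.goto fun _ => emb (some (.inr (.inl (entry pt))))))
          (.load (fun _ => (none, none)) (.goto fun _ => emb (some (.inr (.inr (entry pf))))))
    | some (.inl l) => code pn (fun l => emb (some (.inl l))) ex l
    | some (.inr (.inl l)) => code pt (fun l => emb (some (.inr (.inl l)))) ex l
    | some (.inr (.inr l)) => code pf (fun l => emb (some (.inr (.inr l)))) ex l
  | .seq p q, emb, ex, l => match l with
    | .inl l => code p (fun l => emb (.inl l)) (emb (.inr (entry q))) l
    | .inr l => code q (fun l => emb (.inr l)) ex l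
  | .loop k pt pf, emb, ex, l => match l with
    | none => .pop (some (Fin.ofNat (n + 1) k)) (fun _ o => (none, o)) <|
        .branch (fun v => v.2 == none) (.goto fun _ => ex) <|
        .branch (fun v => v.2 == some true)
          (.load (fun _ => (none, none)) (.goto fun _ => emb (some (.inl (entry pt)))))
          (.load (fun _ => (none, none)) (.goto fun _ => emb (some (.inr (entry pf)))))
    | some (.inl l) => code pt (fun l => emb (some (.inl l))) (emb none) l
    | some (.inr l) => code pf (fun l => emb (some (.inr l))) (emb none) l

variable {n}

/-- The stacks of the machine that hold an input word and a store. -/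
def tapes (w : List A) (S : Store) : ∀ k, List (Alphabet A n k)
  | none => w
  | some i => S i

/-- The bound `k ≤ n` ensures that `Fin.ofNat` does not wrap around, so distinct stacks of the
program stay distinct in the machine. -/
theorem update_tapes (w : List A) (S : Store) {k : ℕ} (hk : k ≤ n) (v : List Bool) :
    update (tapes (n := n) w S) (some (Fin.ofNat (n + 1) k)) v =
      tapes (n := n) w (update S k v) := by
  have hk' : ((Fin.ofNat (n + 1) k : Fin (n + 1)) : ℕ) = k := Nat.mod_eq_of_lt (by omega)
  funext j
  by_cases hj : j = some (Fin.ofNat (n + 1) k)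
  · subst hj
    refine (update_self _ _ _).trans ?_
    change v = update S k v _
    rw [hk', update_self]
  · refine (update_of_ne hj _ _).trans ?_
    cases j with
    | none => rfl
    | some j =>
      change S j = update S k v j
      rw [update_of_ne]
      intro h
      exact hj (congrArg some (Fin.ext (h.trans hk'.symm)))

theorem tapes_some (w : List A) (S : Store) {k : ℕ} (hk : k ≤ n) :
    tapes (n := n) w S (some (Fin.ofNat (n + 1) k)) = S k := by
  change S _ = S k
  congr 1
  exact Nat.mod_eq_of_lt (by omega)

theorem stepAux_pop_tapes {L : Type} (w : List A) (S : Store) {k : ℕ} (hk : k ≤ n)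
    (f : Register A → Option Bool → Register A) (q : TM2.Stmt (Alphabet A n) L (Register A))
    (v : Register A) :
    TM2.stepAux (.pop (some (Fin.ofNat (n + 1) k)) f q) v (tapes w S) =
      TM2.stepAux q (f v (S k).head?) (tapes w (update S k (S k).tail)) := by
  rw [← tapes_some w S hk, ← update_tapes w S hk]
  rfl

theorem stepAux_push_tapes {L : Type} (w : List A) (S : Store) {k : ℕ} (hk : k ≤ n)
    (f : Register A → Bool) (q : TM2.Stmt (Alphabet A n) L (Register A)) (v : Register A) :
    TM2.stepAux (.push (some (Fin.ofNat (n + 1) k)) f q) v (tapes w S) =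
      TM2.stepAux q v (tapes w (update S k (f v :: S k))) := by
  rw [← tapes_some w S hk, ← update_tapes w S hk]
  rfl

/-- The machine configuration at a label. -/
def config {L : Type} (w : List A) (l : L) (S : Store) :
    TM2.Cfg (Alphabet A n) L (Register A) := ⟨some l, (none, none), tapes w S⟩

/-- The machine reaches `c'` from `c` within `t` steps. -/
def Reach {L : Type} (m : L → TM2.Stmt (Alphabet A n) L (Register A))
    (c c' : TM2.Cfg (Alphabet A n) L (Register A)) (t : ℕ) : Prop :=
  Nonempty (StateTransition.EvalsToInTime (TM2.step m) c (some c') t)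

variable {L : Type} {m : L → TM2.Stmt (Alphabet A n) L (Register A)}

theorem Reach.mono {c c' t t'} (h : Reach m c c' t) (ht : t ≤ t') : Reach m c c' t' := by
  obtain ⟨h⟩ := h
  exact ⟨⟨h.toEvalsTo, h.steps_le_m.trans ht⟩⟩

theorem Reach.trans {c c' c'' t t'} (h : Reach m c c' t) (h' : Reach m c' c'' t') :
    Reach m c c'' (t + t') := by
  obtain ⟨h⟩ := h
  obtain ⟨h'⟩ := h'
  exact ⟨add_comm t' t ▸ h.trans _ _ _ _ _ _ h'⟩

theorem Reach.single {l v S c'} (h : TM2.stepAux (m l) v S = c') : Reach m ⟨some l, v, S⟩ c' 1 :=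
  ⟨⟨⟨1, by simp [flip, ← h]⟩, le_rfl⟩⟩

/-- Simulation by induction on the run, with step counts carried over unchanged. The embedding and
the exit label vary in the induction, because each subprogram sits inside the same machine at its
own place and continues elsewhere. -/
theorem Run.reach {p S S' t} (h : Run p S S' t) (w : List A) : ∀ (_ : p.Bounded n)
    (emb : Label p → L) (ex : L) (_ : ∀ l, m (emb l) = code n p emb ex l),
    Reach m (config w (emb (entry p)) S) (config w ex S') t := by
  induction h with
  | skip =>
    intro _ emb ex hm
    exact Reach.single (by rw [hm]; rfl)
  | @push k b S =>
    intro hb emb ex hm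
    refine Reach.single ?_
    rw [hm]
    exact stepAux_push_tapes w S hb _ _ _
  | @pop_nil k pn pt pf S S' t hS _ ih =>
    intro hb emb ex hm
    rw [add_comm]
    refine Reach.trans (Reach.single ?_)
      (ih hb.2.1 (fun l => emb (some (.inl l))) ex fun l => hm (some (.inl l)))
    rw [hm]
    refine (stepAux_pop_tapes w S hb.1 _ _ _).trans ?_
    -- Popping an empty stack changes nothing: writing `[]` back as `S k` makes the update trivial.
    rw [hS, List.tail_nil, ← hS, update_eq_self, hS]
    rfl
  | @pop_true k pn pt pf S S' t u hS _ ih =>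
    intro hb emb ex hm
    rw [add_comm]
    refine Reach.trans (Reach.single ?_)
      (ih hb.2.2.1 (fun l => emb (some (.inr (.inl l)))) ex fun l => hm (some (.inr (.inl l))))
    rw [hm]
    refine (stepAux_pop_tapes w S hb.1 _ _ _).trans ?_
    rw [hS]
    rfl
  | @pop_false k pn pt pf S S' t u hS _ ih =>
    intro hb emb ex hm
    rw [add_comm]
    refine Reach.trans (Reach.single ?_)
      (ih hb.2.2.2 (fun l => emb (some (.inr (.inr l)))) ex fun l => hm (some (.inr (.inr l))))
    rw [hm]
    refine (stepAux_pop_tapes w S hb.1 _ _ _).trans ?_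
    rw [hS]
    rfl
  | seq _ _ ih₁ ih₂ =>
    intro hb emb ex hm
    exact (ih₁ hb.1 (fun l => emb (.inl l)) _ fun l => hm (.inl l)).trans
      (ih₂ hb.2 (fun l => emb (.inr l)) ex fun l => hm (.inr l))
  | @loop_nil k pt pf S hS =>
    intro hb emb ex hm
    refine Reach.single ?_
    rw [hm]
    refine (stepAux_pop_tapes w S hb.1 _ _ _).trans ?_
    rw [hS, List.tail_nil, ← hS, update_eq_self, hS]
    rfl
  | @loop_true k pt pf S S₁ S₂ t₁ t₂ u hS _ _ ih₁ ih₂ =>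
    intro hb emb ex hm
    rw [add_comm]
    refine Reach.trans (Reach.single ?_) ((ih₁ hb.2.1 (fun l => emb (some (.inl l))) (emb none)
      fun l => hm (some (.inl l))).trans (ih₂ hb emb ex hm))
    rw [hm]
    refine (stepAux_pop_tapes w S hb.1 _ _ _).trans ?_
    rw [hS]
    rfl
  | @loop_false k pt pf S S₁ S₂ t₁ t₂ u hS _ _ ih₁ ih₂ =>
    intro hb emb ex hm
    rw [add_comm]
    refine Reach.trans (Reach.single ?_) ((ih₁ hb.2.2 (fun l => emb (some (.inr l))) (emb none)
      fun l => hm (some (.inr l))).trans (ih₂ hb emb ex hm))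
    rw [hm]
    refine (stepAux_pop_tapes w S hb.1 _ _ _).trans ?_
    rw [hS]
    rfl
  | mono _ hle ih =>
    intro hb emb ex hm
    exact (ih hb emb ex hm).mono hle

end Compile

/-! ### The complete machine: reading the input, running the program, writing the answer -/

/-- The labels of the machine that runs `p`. -/
inductive MachineLabel (A : Type) (p : Prog) where
  | start
  | read
  | symbol (a : A)
  | run (l : Label p)
  | finish

noncomputable instance {A : Type} [Fintype A] (p : Prog) : Fintype (MachineLabel A p) := by
  letI := labelFintype p
  classical
  refine Fintype.ofSurjective
    (fun x : Option (Option (Option (A ⊕ Label p))) => match x with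
      | none => MachineLabel.start
      | some none => .read
      | some (some none) => .finish
      | some (some (some (.inl a))) => .symbol a
      | some (some (some (.inr l))) => .run l) ?_
  rintro (_ | _ | a | l | _)
  exacts [⟨none, rfl⟩, ⟨some none, rfl⟩, ⟨some (some (some (.inl a))), rfl⟩,
    ⟨some (some (some (.inr l))), rfl⟩, ⟨some (some none), rfl⟩]

/-- Push a word onto stack `0`. -/
def pushAll {A : Type} {n : ℕ} {L : Type} :
    List Bool → TM2.Stmt (Alphabet A n) L (Register A) → TM2.Stmt (Alphabet A n) L (Register A)
  | [], q => q
  | b :: u, q => pushAll u (.push (some 0) (fun _ => b) q)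

theorem stepAux_pushAll {A : Type} {n : ℕ} {L : Type} (u : List Bool)
    (q : TM2.Stmt (Alphabet A n) L (Register A)) (v : Register A) (w : List A) (S : Store) :
    TM2.stepAux (pushAll u q) v (tapes w S) =
      TM2.stepAux q v (tapes w (update S 0 (u ++ S 0))) := by
  induction u generalizing q with
  | nil => simp [pushAll]
  | cons b u ih =>
    rw [pushAll, ih]
    refine (stepAux_push_tapes (n := n) w _ (Nat.zero_le n) _ _ _).trans ?_
    rw [update_idem, update_self]
    rfl

/-- The statements of the machine that pushes the codes of the input symbols onto stack `0`, above
the symbol `false`, then runs `p`, and finally replaces the contents of stack `0` by its first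
symbol. -/
def machineStmt {A : Type} (c : A → List Bool) (n : ℕ) (p : Prog) :
    MachineLabel A p → TM2.Stmt (Alphabet A n) (MachineLabel A p) (Register A)
  | .start => pushAll [false] (.goto fun _ => .read)
  | .read => .pop none (fun _ o => (o, none)) <|
      .goto fun v => v.1.elim (.run (entry p)) .symbol
  | .symbol a => pushAll (c a) (.load (fun _ => (none, none)) (.goto fun _ => .read))
  | .run l => code n p .run .finish l
  -- The answer is coded by `[true, false, false]` or `[false]`, so three pops empty the stack, and
  -- only the first popped symbol is kept.
  | .finish => .pop (some 0) (fun _ o => (none, o)) <| .pop (some 0) (fun v _ => v) <|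
      .pop (some 0) (fun v _ => v) <| .push (some 0) (fun v => v.2 == some true) <|
      .load (fun _ => (none, none)) .halt

/-- The machine that runs `p` on the code of the reversed input word. -/
noncomputable def machine (A : Type) [Fintype A] (c : A → List Bool) (n : ℕ) (p : Prog) :
    FinTM2 where
  K := StackIdx n
  k₀ := none
  k₁ := some 0
  Γ := Alphabet A n
  Λ := MachineLabel A p
  main := .start
  σ := Register A
  initialState := (none, none)
  Γk₀Fin := inferInstanceAs (Fintype A)
  m := machineStmt c n p

/-- The store whose first stacks are listed, and whose other stacks are empty. -/
def st (l : List (List Bool)) : Store := fun k => l.getD k []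

/-- Each input symbol costs one step to pop and one to push its code; one more step detects the end.
Symbols read later end up on top, hence the reversal. -/
theorem reach_read {A : Type} (c : A → List Bool) {n : ℕ} (p : Prog) (w : List A)
    (u : List Bool) :
    Reach (machineStmt c n p) (config w .read (st [u]))
      (config [] (.run (entry p)) (st [w.reverse.flatMap c ++ u])) (2 * w.length + 1) := by
  induction w generalizing u with
  | nil =>
    refine Reach.single ?_
    simp only [machineStmt, TM2.stepAux]
    have : update (tapes (n := n) ([] : List A) (st [u])) none [] = tapes [] (st [u]) := by
      funext j; cases j <;> rfl
    exact congrArg (fun s => (⟨_, _, s⟩ : TM2.Cfg _ _ _)) this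
  | cons a w ih =>
    have h₁ : Reach (machineStmt c n p) (config (a :: w) .read (st [u]))
        ⟨some (.symbol a), (some a, none), tapes w (st [u])⟩ 1 := by
      refine Reach.single ?_
      simp only [machineStmt, TM2.stepAux]
      have : update (tapes (n := n) (a :: w) (st [u])) none w = tapes w (st [u]) := by
        funext j; cases j <;> rfl
      exact congrArg (fun s => (⟨_, _, s⟩ : TM2.Cfg _ _ _)) this
    have h₂ : Reach (machineStmt c n p) ⟨some (.symbol a), (some a, none), tapes w (st [u])⟩
        (config w .read (st [c a ++ u])) 1 := by
      refine Reach.single ?_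
      rw [machineStmt, stepAux_pushAll]
      have : update (st [u]) 0 (c a ++ st [u] 0) = st [c a ++ u] := by
        funext j; cases j <;> rfl
      rw [this]
      rfl
    have h₃ := (h₁.trans h₂).trans (ih (c a ++ u))
    rw [← List.append_assoc, ← List.flatMap_singleton c a, ← List.flatMap_append,
      ← List.reverse_cons] at h₃
    exact h₃.mono (by rw [List.length_cons]; omega)

theorem reach_machine {A : Type} [Fintype A] (c : A → List Bool) {n : ℕ} {p : Prog}
    (hp : p.Bounded n) {w : List A} {b : Bool} {t : ℕ}
    (h : Run p (st [w.reverse.flatMap c ++ [false]])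
      (st [if b then [true, false, false] else [false]]) t) :
    Nonempty (TM2OutputsInTime (machine A c n p) w (some [b]) (2 * w.length + t + 3)) := by
  have h₁ : Reach (machineStmt c n p) ⟨some .start, (none, none), tapes w (st [])⟩
      (config w .read (st [[false]])) 1 := by
    refine Reach.single ?_
    rw [machineStmt, stepAux_pushAll]
    have : update (st []) 0 ([false] ++ st [] 0) = st [[false]] := by
      funext j; cases j <;> rfl
    rw [this]
    rfl
  have h₂ := h.reach (m := machineStmt c n p) ([] : List A) hp .run .finish fun _ => rfl
  have h₃ : Reach (machineStmt c n p)
      (config [] .finish (st [if b then [true, false, false] else [false]]))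
      ⟨none, (none, none), tapes [] (st [[b]])⟩ 1 := by
    refine Reach.single ?_
    have hst : ∀ u v, update (st [u]) 0 v = st [v] := by
      intro u v; funext j; cases j <;> rfl
    refine (stepAux_pop_tapes [] _ (Nat.zero_le n) _ _ _).trans ?_
    refine (stepAux_pop_tapes [] _ (Nat.zero_le n) _ _ _).trans ?_
    refine (stepAux_pop_tapes [] _ (Nat.zero_le n) _ _ _).trans ?_
    refine (stepAux_push_tapes [] _ (Nat.zero_le n) _ _ _).trans ?_
    simp only [hst]
    cases b <;> rfl
  have key := ((h₁.trans (reach_read c p w [false])).trans h₂).trans h₃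
  have hinit : initList (machine A c n p) w =
      (⟨some .start, (none, none), tapes w (st [])⟩ : TM2.Cfg _ _ _) := by
    refine congrArg (fun s => (⟨_, _, s⟩ : TM2.Cfg _ _ _)) ?_
    funext j
    cases j <;> rfl
  have hhalt : haltList (machine A c n p) [b] =
      (⟨none, (none, none), tapes [] (st [[b]])⟩ : TM2.Cfg _ _ _) := by
    refine congrArg (fun s => (⟨_, _, s⟩ : TM2.Cfg _ _ _)) ?_
    funext j
    cases j with
    | none => rfl
    | some j =>
      by_cases hj : j = 0
      · subst hj; rfl
      · have hj' : (some j : StackIdx n) ≠ some 0 := by simpa using hj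
        refine (dif_neg hj').trans ?_
        obtain ⟨i, rfl⟩ := Fin.exists_succ_eq_of_ne_zero hj
        rfl
  obtain ⟨k⟩ := key.mono (t' := 2 * w.length + t + 3) (by omega)
  refine ⟨?_⟩
  unfold TM2OutputsInTime
  rw [Option.map_some, hinit, hhalt]
  exact k

end StackProgram

/-! ### Polynomial time functions between types with tree encodings -/

namespace StackProgram

open Function

/-! #### Stores with finitely many nonempty stacks -/

theorem st_set (l : List (List Bool)) {k : ℕ} (hk : k < l.length) (v : List Bool) :
    update (st l) k v = st (l.set k v) := by
  funext j
  by_cases hj : j = k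
  · subst hj; simp [st, hk]
  · simp [st, hj, Ne.symm hj]

/-- Trailing empty stacks are invisible, so programs that need different numbers of scratch stacks
can be composed. -/
theorem st_pad (l : List (List Bool)) (n : ℕ) : st (l ++ List.replicate n []) = st l := by
  funext j
  by_cases hj : j < l.length
  · simp [st, List.getElem?_append_left hj]
  · push Not at hj
    simp only [st, List.getD_eq_getElem?_getD, List.getElem?_append_right hj,
      List.getElem?_replicate, List.getElem?_eq_none hj]
    split <;> rfl

/-- Rename every stack `k` to `k + 1`. -/
def Prog.shift : Prog → Prog
  | skip => skip
  | push k b => push (k + 1) b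
  | pop k pn pt pf => pop (k + 1) pn.shift pt.shift pf.shift
  | seq p q => seq p.shift q.shift
  | loop k pt pf => loop (k + 1) pt.shift pf.shift

/-- Add a stack below index `0`. -/
def consStore (w : List Bool) (S : Store) : Store
  | 0 => w
  | k + 1 => S k

theorem update_consStore (w : List Bool) (S : Store) (k : ℕ) (v : List Bool) :
    update (consStore w S) (k + 1) v = consStore w (update S k v) := by
  funext j
  cases j with
  | zero => simp [consStore]
  | succ j =>
    by_cases hj : j = k
    · subst hj; simp [consStore]
    · simp [consStore, hj]

theorem consStore_st (w : List Bool) (l : List (List Bool)) :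
    consStore w (st l) = st (w :: l) := by
  funext j
  cases j <;> simp [consStore, st]

theorem Run.shift_consStore {p S S' t} (w : List Bool) (h : Run p S S' t) :
    Run p.shift (consStore w S) (consStore w S') t := by
  induction h with
  | skip => exact .skip
  | @push k b S =>
    rw [← update_consStore]
    exact .push
  | pop_nil hS _ ih => exact .pop_nil hS ih
  | pop_true hS _ ih => exact .pop_true hS (by rwa [update_consStore])
  | pop_false hS _ ih => exact .pop_false hS (by rwa [update_consStore])
  | seq _ _ ih₁ ih₂ => exact .seq ih₁ ih₂
  | loop_nil hS => exact .loop_nil hS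
  | loop_true hS _ _ ih₁ ih₂ => exact .loop_true hS (by rwa [update_consStore]) ih₂
  | loop_false hS _ _ ih₁ ih₂ => exact .loop_false hS (by rwa [update_consStore]) ih₂
  | mono _ hle ih => exact ih.mono hle

/-- A frame rule: data can be kept on stack `0` while a shifted program works on the stacks above
it. -/
theorem Run.shift {p l l' t} (w : List Bool) (h : Run p (st l) (st l') t) :
    Run p.shift (st (w :: l)) (st (w :: l')) t := by
  rw [← consStore_st, ← consStore_st]
  exact h.shift_consStore w

/-! #### Basic programs -/

theorem Run.push_st (l : List (List Bool)) (k : ℕ) (b : Bool) (hk : k < l.length) :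
    Run (.push k b) (st l) (st (l.set k (b :: l.getD k []))) 1 := by
  rw [← st_set l hk]
  exact .push

theorem Run.pop_true_st {l : List (List Bool)} {k : ℕ} {pn pt pf S' t} (w : List Bool)
    (hk : k < l.length) (h : l.getD k [] = true :: w) (hr : Run pt (st (l.set k w)) S' t) :
    Run (.pop k pn pt pf) (st l) S' (t + 1) := by
  rw [← st_set l hk] at hr
  exact .pop_true h hr

theorem Run.pop_false_st {l : List (List Bool)} {k : ℕ} {pn pt pf S' t} (w : List Bool)
    (hk : k < l.length) (h : l.getD k [] = false :: w) (hr : Run pf (st (l.set k w)) S' t) :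
    Run (.pop k pn pt pf) (st l) S' (t + 1) := by
  rw [← st_set l hk] at hr
  exact .pop_false h hr

theorem Run.loop_true_st {l : List (List Bool)} {k : ℕ} {pt pf S₁ S' t₁ t₂} (w : List Bool)
    (hk : k < l.length) (h : l.getD k [] = true :: w) (h₁ : Run pt (st (l.set k w)) S₁ t₁)
    (h₂ : Run (.loop k pt pf) S₁ S' t₂) : Run (.loop k pt pf) (st l) S' (t₁ + t₂ + 1) := by
  rw [← st_set l hk] at h₁
  exact .loop_true h h₁ h₂

theorem Run.loop_false_st {l : List (List Bool)} {k : ℕ} {pt pf S₁ S' t₁ t₂} (w : List Bool)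
    (hk : k < l.length) (h : l.getD k [] = false :: w) (h₁ : Run pf (st (l.set k w)) S₁ t₁)
    (h₂ : Run (.loop k pt pf) S₁ S' t₂) : Run (.loop k pt pf) (st l) S' (t₁ + t₂ + 1) := by
  rw [← st_set l hk] at h₁
  exact .loop_false h h₁ h₂

/-- Move stack `i` onto stack `j`, in reverse order. -/
def rev (i j : ℕ) : Prog := .loop i (.push j true) (.push j false)

theorem run_rev_aux (i j : ℕ) (hij : i ≠ j) (u : List Bool) : ∀ S : Store, S i = u →
    Run (rev i j) S (update (update S i []) j (u.reverse ++ S j)) (2 * u.length + 1) := by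
  induction u with
  | nil =>
    intro S hS
    have : update (update S i []) j (([] : List Bool).reverse ++ S j) = S := by
      rw [← hS, update_eq_self]; simp [hS]
    rw [this]
    exact .loop_nil hS
  | cons b u ih =>
    intro S hS
    have h := ih (update (update S i u) j (b :: S j)) (by
      rw [update_of_ne hij, update_self])
    have e : update (update (update (update S i u) j (b :: S j)) i []) j
        (u.reverse ++ update (update S i u) j (b :: S j) j) =
        update (update S i []) j ((b :: u).reverse ++ S j) := by
      rw [update_comm hij.symm, update_idem, update_idem, update_self]
      simp
    rw [e] at h
    have hp : ∀ b, Run (.push j b) (update S i u) (update (update S i u) j (b :: S j)) 1 := by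
      intro b
      have := Run.push (k := j) (b := b) (S := update S i u)
      rwa [update_of_ne hij.symm] at this
    cases b
    · exact (Run.loop_false hS (hp _) h).mono (by simp; omega)
    · exact (Run.loop_true hS (hp _) h).mono (by simp; omega)

theorem run_rev (l : List (List Bool)) (i j : ℕ) (hij : i ≠ j) (hi : i < l.length)
    (hj : j < l.length) :
    Run (rev i j) (st l) (st ((l.set i []).set j ((l.getD i []).reverse ++ l.getD j [])))
      (2 * (l.getD i []).length + 1) := by
  rw [← st_set _ (by simpa using hj), ← st_set _ hi]
  exact run_rev_aux i j hij _ _ rfl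

/-- Empty stack `i`. -/
def clear (i : ℕ) : Prog := .loop i .skip .skip

theorem run_clear_aux (i : ℕ) (u : List Bool) : ∀ S : Store, S i = u →
    Run (clear i) S (update S i []) (2 * u.length + 1) := by
  induction u with
  | nil =>
    intro S hS
    have : update S i [] = S := by rw [← hS, update_eq_self]
    rw [this]
    exact .loop_nil hS
  | cons b u ih =>
    intro S hS
    have h := ih (update S i u) (by simp)
    rw [update_idem] at h
    cases b
    · exact (Run.loop_false hS .skip h).mono (by simp; omega)
    · exact (Run.loop_true hS .skip h).mono (by simp; omega)

theorem run_clear (l : List (List Bool)) (i : ℕ) (hi : i < l.length) :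
    Run (clear i) (st l) (st (l.set i [])) (2 * (l.getD i []).length + 1) := by
  rw [← st_set _ hi]
  exact run_clear_aux i _ _ rfl

/-- Copy stack `i`, in reverse order, onto the stacks `j` and `k`, and empty it. -/
def copy (i j k : ℕ) : Prog :=
  .loop i (.seq (.push j true) (.push k true)) (.seq (.push j false) (.push k false))

theorem run_copy_aux (i j k : ℕ) (hij : i ≠ j) (hik : i ≠ k) (hjk : j ≠ k) (u : List Bool) :
    ∀ S : Store, S i = u → Run (copy i j k) S
      (update (update (update S i []) j (u.reverse ++ S j)) k (u.reverse ++ S k))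
      (3 * u.length + 1) := by
  induction u with
  | nil =>
    intro S hS
    have : update (update (update S i []) j (([] : List Bool).reverse ++ S j)) k
        (([] : List Bool).reverse ++ S k) = S := by
      rw [← hS, update_eq_self]; simp [hS]
    rw [this]
    exact .loop_nil hS
  | cons b u ih =>
    intro S hS
    have h := ih (update (update (update S i u) j (b :: S j)) k (b :: S k)) (by
      rw [update_of_ne hik, update_of_ne hij, update_self])
    have e : update (update (update (update (update (update S i u) j (b :: S j)) k (b :: S k)) i
          []) j (u.reverse ++ update (update (update S i u) j (b :: S j)) k (b :: S k) j)) k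
          (u.reverse ++ update (update (update S i u) j (b :: S j)) k (b :: S k) k) =
        update (update (update S i []) j ((b :: u).reverse ++ S j)) k
          ((b :: u).reverse ++ S k) := by
      rw [update_self, update_of_ne hjk, update_self, update_comm hik.symm, update_comm hij.symm,
        update_idem, update_comm hjk.symm, update_idem, update_idem]
      simp
    rw [e] at h
    have hp : ∀ b, Run (.seq (.push j b) (.push k b)) (update S i u)
        (update (update (update S i u) j (b :: S j)) k (b :: S k)) 2 := by
      intro b
      have h₁ := Run.push (k := j) (b := b) (S := update S i u)
      rw [update_of_ne hij.symm] at h₁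
      have h₂ := Run.push (k := k) (b := b) (S := update (update S i u) j (b :: S j))
      rw [update_of_ne hjk.symm, update_of_ne hik.symm] at h₂
      exact .seq h₁ h₂
    cases b
    · exact (Run.loop_false hS (hp _) h).mono (by simp; omega)
    · exact (Run.loop_true hS (hp _) h).mono (by simp; omega)

theorem run_copy (l : List (List Bool)) (i j k : ℕ) (hij : i ≠ j) (hik : i ≠ k) (hjk : j ≠ k)
    (hi : i < l.length) (hj : j < l.length) (hk : k < l.length) :
    Run (copy i j k) (st l)
      (st (((l.set i []).set j ((l.getD i []).reverse ++ l.getD j [])).set k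
        ((l.getD i []).reverse ++ l.getD k []))) (3 * (l.getD i []).length + 1) := by
  rw [← st_set _ (by simpa using hk), ← st_set _ (by simpa using hj), ← st_set _ hi]
  exact run_copy_aux i j k hij hik hjk _ _ rfl

/-- Push a word onto stack `0`. -/
def pushWord : List Bool → Prog
  | [] => .skip
  | b :: u => .seq (pushWord u) (.push 0 b)

theorem run_pushWord (u v : List Bool) : Run (pushWord u) (st [v]) (st [u ++ v]) (u.length + 1) := by
  induction u with
  | nil => exact .skip
  | cons b u ih => exact (Run.seq ih (Run.push_st [u ++ v] 0 b (by simp))).mono (by simp)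

/-! #### Trees and their codes -/

/-- Binary trees, the universal data type. -/
inductive Tree where
  | leaf
  | node (l r : Tree)

/-- The preorder code of a tree. -/
def Tree.code : Tree → List Bool
  | leaf => [false]
  | node l r => true :: (l.code ++ r.code)

/-- Preorder codes delimit themselves. The arbitrary tails are needed in the induction, where the
code of a left subtree is followed by that of the right one. -/
theorem Tree.code_append_inj : ∀ (t u : Tree) (a b : List Bool),
    t.code ++ a = u.code ++ b → t = u ∧ a = b := by
  intro t
  induction t with
  | leaf =>
    intro u a b h
    cases u with
    | leaf => simpa [code] using h
    | node l r => simp [code] at h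
  | node l r ihl ihr =>
    intro u a b h
    cases u with
    | leaf => simp [code] at h
    | node l' r' =>
      simp only [code, List.cons_append, List.append_assoc, List.cons.injEq, true_and] at h
      obtain ⟨hl, h'⟩ := ihl _ _ _ h
      obtain ⟨hr, hab⟩ := ihr _ _ _ h'
      exact ⟨by rw [hl, hr], hab⟩

theorem Tree.code_injective : Injective Tree.code := fun t u h =>
  (Tree.code_append_inj t u [] [] (by simp [h])).1

theorem Tree.code_length_pos (t : Tree) : 0 < t.code.length := by
  cases t <;> simp [code]

/-- Left subtree. -/
def Tree.left : Tree → Tree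
  | leaf => leaf
  | node l _ => l

/-- Right subtree. -/
def Tree.right : Tree → Tree
  | leaf => leaf
  | node _ r => r

/-- Read the trees counted by stack `5` from stack `0`, and push their codes onto stack `4`. -/
def readLoop : Prog :=
  .loop 5 (.pop 0 .skip (.seq (.push 4 true) (.seq (.push 5 true) (.push 5 true)))
    (.push 4 false)) .skip

/-- Stack `5` counts in unary the subtrees still to be read: each round takes one away, and a node
gives back two. A node symbol costs five steps and a leaf three, whence the factor 5. The statement
prepends the reading of `t` to an arbitrary continuation, so the two subtrees chain. -/
theorem run_readLoop (t : Tree) : ∀ (r a b c v cnt : List Bool) {S' : Store} {n : ℕ},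
    Run readLoop (st [r, a, b, c, t.code.reverse ++ v, cnt]) S' n →
    Run readLoop (st [t.code ++ r, a, b, c, v, true :: cnt]) S' (5 * t.code.length + n) := by
  induction t with
  | leaf =>
    intro r a b c v cnt S' n h
    refine (Run.loop_true_st cnt (by simp) rfl (Run.pop_false_st r (by simp) rfl
      (Run.push_st [r, a, b, c, v, cnt] 4 false (by simp))) h).mono ?_
    simp [Tree.code]
  | node l r' ihl ihr =>
    intro r a b c v cnt S' n h
    have e₁ : (Tree.node l r').code ++ r = true :: (l.code ++ (r'.code ++ r)) := by
      simp [Tree.code]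
    have e₂ : (Tree.node l r').code.reverse ++ v =
        r'.code.reverse ++ (l.code.reverse ++ (true :: v)) := by
      simp [Tree.code]
    rw [e₂] at h
    rw [e₁]
    have h' := ihl _ a b c _ _ (ihr _ a b c _ _ h)
    have hb : Run (.seq (.push 4 true) (.seq (.push 5 true) (.push 5 true)))
        (st [l.code ++ (r'.code ++ r), a, b, c, v, cnt])
        (st [l.code ++ (r'.code ++ r), a, b, c, true :: v, true :: true :: cnt]) (1 + (1 + 1)) :=
      .seq (Run.push_st [l.code ++ (r'.code ++ r), a, b, c, v, cnt] 4 true (by simp))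
        (.seq (Run.push_st [l.code ++ (r'.code ++ r), a, b, c, true :: v, cnt] 5 true (by simp))
          (Run.push_st [l.code ++ (r'.code ++ r), a, b, c, true :: v, true :: cnt] 5 true
            (by simp)))
    refine (Run.loop_true_st cnt (by simp) rfl (Run.pop_true_st (l.code ++ (r'.code ++ r))
      (by simp) rfl hb) h').mono ?_
    simp [Tree.code]; omega

/-- Read a tree from stack `0`, and push its code onto stack `4`, in reverse order. -/
def read : Prog := .seq (.push 5 true) readLoop

theorem run_read (t : Tree) (r a b c : List Bool) :
    Run read (st [t.code ++ r, a, b, c, [], []]) (st [r, a, b, c, t.code.reverse, []])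
      (5 * t.code.length + 2) := by
  refine (Run.seq (Run.push_st [t.code ++ r, a, b, c, [], []] 5 true (by simp))
    (run_readLoop t r a b c [] [] (n := 1) ?_)).mono (by omega)
  rw [List.append_nil]
  exact .loop_nil rfl

/-! #### Encodings and polynomial time functions -/

/-- Types whose elements are encoded by trees. -/
class Enc (α : Type) where
  enc : α → Tree
  enc_injective : Injective enc

open Enc

/-- The code of an element. -/
def cd {α : Type} [Enc α] (a : α) : List Bool := (enc a).code

/-- The length of the code of an element. -/
def size {α : Type} [Enc α] (a : α) : ℕ := (cd a).length

instance : Enc Bool where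
  enc b := if b then .node .leaf .leaf else .leaf
  enc_injective := by intro a b; cases a <;> cases b <;> simp

instance {α β : Type} [Enc α] [Enc β] : Enc (α × β) where
  enc x := .node (enc x.1) (enc x.2)
  enc_injective := by
    rintro ⟨a, b⟩ ⟨a', b'⟩ h
    simp only [Tree.node.injEq] at h
    rw [enc_injective h.1, enc_injective h.2]

/-- The tree of a list. -/
def encList {α : Type} [Enc α] : List α → Tree
  | [] => .leaf
  | a :: l => .node (enc a) (encList l)

theorem encList_injective {α : Type} [Enc α] : Injective (encList (α := α)) := by
  intro l
  induction l with
  | nil => intro l' h; cases l' <;> simp_all [encList]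
  | cons a l ih =>
    intro l' h
    cases l' with
    | nil => simp [encList] at h
    | cons b l' =>
      simp only [encList, Tree.node.injEq] at h
      rw [enc_injective h.1, ih h.2]

instance {α : Type} [Enc α] : Enc (List α) where
  enc := encList
  enc_injective := encList_injective

/-! ### Sizes of codes of pairs and lists -/

section Sizes

variable {α β : Type} [Enc α] [Enc β]

theorem cd_pair (a : α) (b : β) : cd (a, b) = true :: (cd a ++ cd b) := rfl

theorem cd_cons (a : α) (l : List α) : cd (a :: l) = true :: (cd a ++ cd l) := rfl

theorem length_cd (a : α) : (cd a).length = size a := rfl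

theorem size_pair (a : α) (b : β) : size (a, b) = size a + size b + 1 := by
  simp [size, cd_pair]

theorem size_nil : size ([] : List α) = 1 := rfl

theorem size_cons (a : α) (l : List α) : size (a :: l) = size a + size l + 1 := by
  simp [size, cd_cons]

theorem size_pos (a : α) : 0 < size a := Tree.code_length_pos _

theorem size_bool_le (b : Bool) : size b ≤ 3 := by cases b <;> decide

theorem size_append (l m : List α) : size (l ++ m) + 1 = size l + size m := by
  induction l with
  | nil => simp [size_nil]; omega
  | cons a l ih => rw [List.cons_append, size_cons, size_cons]; omega

theorem size_reverse (l : List α) : size l.reverse = size l := by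
  induction l with
  | nil => rfl
  | cons a l ih =>
    have := size_append l.reverse [a]
    rw [List.reverse_cons, size_cons]
    rw [size_cons, size_nil] at this
    omega

theorem size_le_of_sublist {l m : List α} (h : l.Sublist m) : size l ≤ size m := by
  induction h with
  | slnil => rfl
  | cons a _ ih => rw [size_cons]; omega
  | cons_cons a _ ih => rw [size_cons, size_cons]; omega

theorem length_le_size (l : List α) : l.length ≤ size l := by
  induction l with
  | nil => simp
  | cons a l ih => rw [size_cons, List.length_cons]; omega

theorem size_le_of_mem {l : List α} {a : α} (h : a ∈ l) : size a ≤ size l := by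
  induction l with
  | nil => simp at h
  | cons b l ih =>
    rw [size_cons]
    rcases List.mem_cons.1 h with rfl | h
    · omega
    · have := ih h; omega

end Sizes

theorem eval_mono (T : Polynomial ℕ) {m n : ℕ} (h : m ≤ n) : T.eval m ≤ T.eval n := by
  rw [Polynomial.eval_eq_sum, Polynomial.eval_eq_sum]
  exact Finset.sum_le_sum fun i _ => Nat.mul_le_mul_left _ (Nat.pow_le_pow_left h i)

/-- `f` is computed by a program in polynomial time. -/
def Poly {α β : Type} [Enc α] [Enc β] (f : α → β) : Prop :=
  ∃ (p : Prog) (T : Polynomial ℕ), ∀ a, Run p (st [cd a]) (st [cd (f a)]) (T.eval (size a))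

/-! ### Basic polynomial time functions: composition, pairs, branching, subtrees -/

namespace Poly

variable {α β γ : Type} [Enc α] [Enc β] [Enc γ]

/-- A program pushes at most one symbol per step, so its running time also bounds its output. Bounds
for composed programs rest on this. -/
theorem size_le {f : α → β} (hf : Poly f) :
    ∃ B : Polynomial ℕ, ∀ a, size (f a) ≤ B.eval (size a) := by
  obtain ⟨p, T, h⟩ := hf
  refine ⟨.X + T, fun a => ?_⟩
  have := (h a).length_le 0
  simpa [st, length_cd] using this

/-- Programs see only trees, so a function may be exchanged for one into another type with the same
output trees. Constructors and projections of encoded types are obtained in this way from pairs. -/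
theorem of_enc {f : α → β} {g : α → γ} (hg : Poly g) (h : ∀ a, enc (f a) = enc (g a)) :
    Poly f := by
  obtain ⟨p, T, hp⟩ := hg
  refine ⟨p, T, fun a => ?_⟩
  have : cd (f a) = cd (g a) := congrArg Tree.code (h a)
  rw [this]
  exact hp a

theorem of_eq {f g : α → β} (hg : Poly g) (h : ∀ a, f a = g a) : Poly f :=
  (funext h : f = g) ▸ hg

theorem id : Poly fun a : α => a := ⟨.skip, 1, fun a => by simpa using Run.skip⟩

theorem comp {g : β → γ} {f : α → β} (hg : Poly g) (hf : Poly f) : Poly fun a => g (f a) := by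
  obtain ⟨B, hB⟩ := hf.size_le
  obtain ⟨p, T, hp⟩ := hf
  obtain ⟨q, U, hq⟩ := hg
  refine ⟨.seq p q, T + U.comp B, fun a => ((hp a).seq (hq (f a))).mono ?_⟩
  have := eval_mono U (hB a)
  simp only [Polynomial.eval_add, Polynomial.eval_comp]
  omega

theorem const (b : β) : Poly fun _ : α => b := by
  refine ⟨.seq (clear 0) (pushWord (cd b)), .C 2 * .X + .C (size b + 2), fun a => ?_⟩
  have h₁ : Run (clear 0) (st [cd a]) (st [[]]) (2 * size a + 1) := run_clear [cd a] 0 (by simp)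
  have h₂ := run_pushWord (cd b) []
  rw [List.append_nil] at h₂
  refine (h₁.seq h₂).mono ?_
  simp only [Polynomial.eval_add, Polynomial.eval_mul, Polynomial.eval_C, Polynomial.eval_X,
    length_cd]
  omega

/-- Duplicate stack `0` to stack `1`. -/
def dup : Prog := .seq (copy 0 1 2) (.seq (rev 1 0) (rev 2 1))

theorem run_dup (x : List Bool) : Run dup (st [x]) (st [x, x]) (7 * x.length + 3) := by
  have h₁ : Run (copy 0 1 2) (st [x, [], []]) (st [[], x.reverse, x.reverse]) (3 * x.length + 1) :=
    by simpa using run_copy [x, [], []] 0 1 2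
  have h₂ : Run (rev 1 0) (st [[], x.reverse, x.reverse]) (st [x, [], x.reverse])
    (2 * x.length + 1) := by simpa using run_rev [[], x.reverse, x.reverse] 1 0
  have h₃ : Run (rev 2 1) (st [x, [], x.reverse]) (st [x, x, []]) (2 * x.length + 1) := by
    simpa using run_rev [x, [], x.reverse] 2 1
  have e₁ : st [x, [], []] = st [x] := st_pad [x] 2
  have e₂ : st [x, x, []] = st [x, x] := st_pad [x, x] 1
  rw [e₁] at h₁
  rw [e₂] at h₃
  exact (h₁.seq (h₂.seq h₃)).mono (by omega)

/-- Exchange the stacks `0` and `1`. -/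
def swap : Prog := .seq (rev 0 2) (.seq (rev 1 3) (.seq (rev 3 0) (rev 2 1)))

theorem run_swap (x y : List Bool) :
    Run swap (st [x, y]) (st [y, x]) (4 * x.length + 4 * y.length + 4) := by
  have h₁ : Run (rev 0 2) (st [x, y, [], []]) (st [[], y, x.reverse, []]) (2 * x.length + 1) := by
    simpa using run_rev [x, y, [], []] 0 2
  have h₂ : Run (rev 1 3) (st [[], y, x.reverse, []]) (st [[], [], x.reverse, y.reverse])
    (2 * y.length + 1) := by simpa using run_rev [[], y, x.reverse, []] 1 3
  have h₃ : Run (rev 3 0) (st [[], [], x.reverse, y.reverse]) (st [y, [], x.reverse, []])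
    (2 * y.length + 1) := by simpa using run_rev [[], [], x.reverse, y.reverse] 3 0
  have h₄ : Run (rev 2 1) (st [y, [], x.reverse, []]) (st [y, x, [], []])
    (2 * x.length + 1) := by simpa using run_rev [y, [], x.reverse, []] 2 1
  have e : ∀ x y, st [x, y, [], []] = st [x, y] := fun x y => st_pad [x, y] 2
  rw [e] at h₁ h₄
  exact (h₁.seq (h₂.seq (h₃.seq h₄))).mono (by omega)

/-- Replace `x`, `y` on the stacks `0`, `1` by `true :: (x ++ y)` on stack `0`. -/
def join : Prog :=
  .seq (rev 0 2) (.seq (rev 2 1) (.seq (.push 1 true) (.seq (rev 1 2) (rev 2 0))))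

theorem run_join (x y : List Bool) : Run join (st [x, y]) (st [true :: (x ++ y)])
    (8 * x.length + 4 * y.length + 9) := by
  have h₁ : Run (rev 0 2) (st [x, y, []]) (st [[], y, x.reverse]) (2 * x.length + 1) := by
    simpa using run_rev [x, y, []] 0 2
  have h₂ : Run (rev 2 1) (st [[], y, x.reverse]) (st [[], x ++ y, []]) (2 * x.length + 1) := by
    simpa using run_rev [[], y, x.reverse] 2 1
  have h₃ : Run (.push 1 true) (st [[], x ++ y, []]) (st [[], true :: (x ++ y), []]) 1 := by
    simpa using Run.push_st [[], x ++ y, []] 1 true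
  generalize hz : true :: (x ++ y) = z at h₃ ⊢
  have hl : z.length = x.length + y.length + 1 := by simp [← hz]
  have h₄ : Run (rev 1 2) (st [[], z, []]) (st [[], [], z.reverse]) (2 * z.length + 1) := by
    simpa using run_rev [[], z, []] 1 2
  have h₅ : Run (rev 2 0) (st [[], [], z.reverse]) (st [z, [], []]) (2 * z.length + 1) := by
    simpa using run_rev [[], [], z.reverse] 2 0
  have e₁ : st [x, y, []] = st [x, y] := st_pad [x, y] 1
  have e₂ : st [z, [], []] = st [z] := st_pad [z] 2
  rw [e₁] at h₁
  rw [e₂] at h₅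
  exact (h₁.seq (h₂.seq (h₃.seq (h₄.seq h₅)))).mono (by omega)

/-- The input is duplicated; one copy is kept below while the first program runs, then the stacks
are exchanged and the first result is kept below while the second program runs. -/
theorem pair {f : α → β} {g : α → γ} (hf : Poly f) (hg : Poly g) :
    Poly fun a => (f a, g a) := by
  obtain ⟨B, hB⟩ := hf.size_le
  obtain ⟨B', hB'⟩ := hg.size_le
  obtain ⟨p, T, hp⟩ := hf
  obtain ⟨q, U, hq⟩ := hg
  refine ⟨.seq dup (.seq p.shift (.seq swap (.seq q.shift join))),
    .C 11 * .X + T + U + .C 12 * B + .C 4 * B' + .C 16, fun a => ?_⟩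
  refine ((run_dup (cd a)).seq (((hp a).shift (cd a)).seq ((run_swap _ _).seq
    (((hq a).shift (cd (f a))).seq (run_join _ _))))).mono ?_
  have := hB a
  have := hB' a
  simp only [Polynomial.eval_add, Polynomial.eval_mul, Polynomial.eval_C, Polynomial.eval_X,
    length_cd]
  omega

theorem ite {c : α → Bool} {f g : α → β} (hc : Poly c) (hf : Poly f) (hg : Poly g) :
    Poly fun a => bif c a then f a else g a := by
  obtain ⟨r, V, hr⟩ := hc
  obtain ⟨p, T, hp⟩ := hf
  obtain ⟨q, U, hq⟩ := hg
  -- The first popped symbol of the test decides the branch; for `true`, two further symbols of its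
  -- code `[true, false, false]` are removed.
  refine ⟨.seq dup (.seq r.shift (.pop 1 .skip (.pop 1 .skip .skip (.pop 1 .skip .skip p)) q)),
    .C 7 * .X + T + U + V + .C 6, fun a => ?_⟩
  have e : st [cd a, []] = st [cd a] := st_pad [cd a] 1
  have h₂ : Run (.pop 1 .skip (.pop 1 .skip .skip (.pop 1 .skip .skip p)) q)
      (st [cd a, cd (c a)]) (st [cd (bif c a then f a else g a)])
      (T.eval (size a) + U.eval (size a) + 3) := by
    cases c a with
    | false =>
      refine (Run.pop_false_st [] (by simp) rfl (e ▸ hq a : Run q (st [cd a, []]) _ _)).mono ?_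
      omega
    | true =>
      refine (Run.pop_true_st [false, false] (by simp) rfl (Run.pop_false_st [false] (by simp) rfl
        (Run.pop_false_st [] (by simp) rfl
          (e ▸ hp a : Run p (st [cd a, []]) _ _)))).mono ?_
      omega
  refine (Run.seq (run_dup (cd a)) (((hr a).shift (cd a)).seq h₂)).mono ?_
  simp only [Polynomial.eval_add, Polynomial.eval_mul, Polynomial.eval_C, Polynomial.eval_X,
    length_cd]
  omega

theorem left {f : α → β} (h : ∀ a, enc (f a) = (enc a).left) : Poly f := by
  -- A leaf is its own left subtree, so the `false` consumed by the pop is put back.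
  refine ⟨.pop 0 .skip (.seq read (.seq (clear 0) (rev 4 0))) (.push 0 false),
    .C 20 * .X + .C 20, fun a => ?_⟩
  rw [size, cd, cd, h a]
  have e : ∀ x, st [x, [], [], [], [], []] = st [x] := fun x => st_pad [x] 5
  rw [← e, ← e]
  cases enc a with
  | leaf =>
    refine (Run.pop_false_st (l := [Tree.leaf.code, [], [], [], [], []]) [] (by simp) rfl
      (Run.push_st [[], [], [], [], [], []] 0 false (by simp))).mono ?_
    simp
  | node l r =>
    have h₂ : Run (clear 0) (st [r.code, [], [], [], l.code.reverse, []])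
        (st [[], [], [], [], l.code.reverse, []]) (2 * r.code.length + 1) :=
      run_clear [r.code, [], [], [], l.code.reverse, []] 0 (by simp)
    have h₃ : Run (rev 4 0) (st [[], [], [], [], l.code.reverse, []])
        (st [l.code, [], [], [], [], []]) (2 * l.code.length + 1) := by
      simpa using run_rev [[], [], [], [], l.code.reverse, []] 4 0
    refine (Run.pop_true_st (l := [(Tree.node l r).code, [], [], [], [], []])
      (l.code ++ r.code) (by simp) rfl (Run.seq (run_read l r.code [] [] [])
        (h₂.seq h₃))).mono ?_
    simp [Tree.code]; omega

theorem right {f : α → β} (h : ∀ a, enc (f a) = (enc a).right) : Poly f := by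
  refine ⟨.pop 0 .skip (.seq read (clear 4)) (.push 0 false),
    .C 20 * .X + .C 20, fun a => ?_⟩
  rw [size, cd, cd, h a]
  have e : ∀ x, st [x, [], [], [], [], []] = st [x] := fun x => st_pad [x] 5
  rw [← e, ← e]
  cases enc a with
  | leaf =>
    refine (Run.pop_false_st (l := [Tree.leaf.code, [], [], [], [], []]) [] (by simp) rfl
      (Run.push_st [[], [], [], [], [], []] 0 false (by simp))).mono ?_
    simp
  | node l r =>
    refine (Run.pop_true_st (l := [(Tree.node l r).code, [], [], [], [], []])
      (l.code ++ r.code) (by simp) rfl (Run.seq (run_read l r.code [] [] [])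
        (run_clear [r.code, [], [], [], l.code.reverse, []] 4 (by simp)))).mono ?_
    simp [Tree.code]; omega

/-! #### Equality -/

/-- Compare the stacks `0` and `1`; stack `2` records differences. -/
def cmpLoop : Prog :=
  .loop 1 (.pop 0 (.push 2 true) .skip (.push 2 true)) (.pop 0 (.push 2 true) (.push 2 true) .skip)

/-- A mismatch, or an early end of `y`, leaves a mark on stack `2`, and an excess of `y` stays on
stack `0`. Hence the words agree exactly when both stacks end empty, provided there was no mark
before. -/
theorem run_cmpLoop (x : List Bool) : ∀ y d : List Bool, ∃ y' d' : List Bool,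
    Run cmpLoop (st [y, x, d]) (st [y', [], d']) (3 * x.length + 1) ∧
    y'.length ≤ y.length ∧ d'.length ≤ d.length + x.length ∧
    (y' = [] ∧ d' = [] ↔ x = y ∧ d = []) := by
  induction x with
  | nil =>
    intro y d
    refine ⟨y, d, .loop_nil rfl, le_rfl, by simp, ?_⟩
    rw [eq_comm]
  | cons b x ih =>
    intro y d
    obtain ⟨y₁, d₁, hr, hiff, hy, hd⟩ : ∃ y₁ d₁ : List Bool,
        Run (bif b then (.pop 0 (.push 2 true) .skip (.push 2 true)) else
          (.pop 0 (.push 2 true) (.push 2 true) .skip)) (st [y, x, d]) (st [y₁, x, d₁]) 2 ∧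
        (x = y₁ ∧ d₁ = [] ↔ b :: x = y ∧ d = []) ∧ y₁.length ≤ y.length ∧
        d₁.length ≤ d.length + 1 := by
      rcases y with _ | ⟨c, y⟩
      · refine ⟨[], true :: d, ?_, by simp, by simp, by simp⟩
        cases b
        · exact .pop_nil rfl (Run.push_st [[], x, d] 2 true (by simp))
        · exact .pop_nil rfl (Run.push_st [[], x, d] 2 true (by simp))
      · cases b <;> cases c
        · exact ⟨y, d, Run.pop_false_st y (by simp) rfl .skip, by simp, by simp, by simp⟩
        · exact ⟨y, true :: d, Run.pop_true_st y (by simp) rfl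
            (Run.push_st [y, x, d] 2 true (by simp)), by simp, by simp, by simp⟩
        · exact ⟨y, true :: d, Run.pop_false_st y (by simp) rfl
            (Run.push_st [y, x, d] 2 true (by simp)), by simp, by simp, by simp⟩
        · exact ⟨y, d, Run.pop_true_st y (by simp) rfl .skip, by simp, by simp, by simp⟩
    obtain ⟨y', d', hr', hy', hd', hiff'⟩ := ih y₁ d₁
    refine ⟨y', d', ?_, by omega, by simp; omega, hiff'.trans hiff⟩
    cases b
    · exact (Run.loop_false_st x (by simp) rfl hr hr').mono (by simp; omega)
    · exact (Run.loop_true_st x (by simp) rfl hr hr').mono (by simp; omega)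

/-- Replace the contents of the stacks `0` and `2` by the code of `false` on stack `0`. -/
def reject : Prog := .seq (clear 0) (.seq (clear 2) (.push 0 false))

theorem run_reject (y d : List Bool) : Run reject (st [y, [], d]) (st [[false], [], []])
    (2 * y.length + 2 * d.length + 3) := by
  have h₁ : Run (clear 0) (st [y, [], d]) (st [[], [], d]) (2 * y.length + 1) :=
    run_clear [y, [], d] 0 (by simp)
  have h₂ : Run (clear 2) (st [[], [], d]) (st [[], [], []]) (2 * d.length + 1) :=
    run_clear [[], [], d] 2 (by simp)
  exact (h₁.seq (h₂.seq (Run.push_st [[], [], []] 0 false (by simp)))).mono (by omega)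

/-- Test whether the stacks `0` and `2` are empty. -/
def finishCmp : Prog :=
  .pop 0 (.pop 2 (pushWord [true, false, false]) reject reject) reject reject

theorem run_finishCmp (y d : List Bool) (b : Bool) (hb : y = [] ∧ d = [] ↔ b = true) :
    Run finishCmp (st [y, [], d]) (st [cd b, [], []]) (2 * y.length + 2 * d.length + 6) := by
  rcases y with _ | ⟨c, y⟩
  · rcases d with _ | ⟨e, d⟩
    · obtain rfl : b = true := by simpa using hb
      have h := run_pushWord [true, false, false] []
      have e : ∀ x, st [x, [], []] = st [x] := fun x => st_pad [x] 2
      rw [← e, ← e] at h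
      exact (Run.pop_nil rfl (.pop_nil rfl h)).mono (by simp)
    · obtain rfl : b = false := by simpa using hb
      cases e
      · exact (Run.pop_nil rfl (Run.pop_false_st d (by simp) rfl (run_reject [] d))).mono
          (by simp; omega)
      · exact (Run.pop_nil rfl (Run.pop_true_st d (by simp) rfl (run_reject [] d))).mono
          (by simp; omega)
  · obtain rfl : b = false := by simpa using hb
    cases c
    · exact (Run.pop_false_st y (by simp) rfl (run_reject y d)).mono (by simp; omega)
    · exact (Run.pop_true_st y (by simp) rfl (run_reject y d)).mono (by simp; omega)

/-- Comparing codes is enough, since `enc` and `Tree.code` are injective. -/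
theorem eq_pair [DecidableEq α] : Poly fun x : α × α => decide (x.1 = x.2) := by
  refine ⟨.pop 0 .skip (.seq read (.seq (rev 4 1) (.seq cmpLoop finishCmp))) .skip,
    .C 20 * .X + .C 20, ?_⟩
  rintro ⟨a, b⟩
  obtain ⟨y', d', hr, hy, hd, hiff⟩ := run_cmpLoop (cd a) (cd b) []
  have h₁ : Run read (st [cd a ++ cd b, [], [], [], [], []])
      (st [cd b, [], [], [], (cd a).reverse, []]) (5 * size a + 2) := by
    simpa [size, cd] using run_read (enc a) (cd b) [] [] []
  have h₂ : Run (rev 4 1) (st [cd b, [], [], [], (cd a).reverse, []])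
      (st [cd b, cd a, [], [], [], []]) (2 * size a + 1) := by
    simpa [length_cd] using run_rev [cd b, [], [], [], (cd a).reverse, []] 4 1
  have e₁ : st [cd b, cd a, [], [], [], []] = st [cd b, cd a, []] :=
    st_pad [cd b, cd a, []] 3
  rw [e₁] at h₂
  have h₃ := run_finishCmp y' d' (decide (a = b)) (by
    rw [hiff, decide_eq_true_iff]
    simp only [and_true]
    exact (Tree.code_injective.comp enc_injective).eq_iff (a := a) (b := b))
  have e₂ : ∀ x, st [x, [], []] = st [x] := fun x => st_pad [x] 2
  have e₃ : ∀ x, st [x, [], [], [], [], []] = st [x] := fun x => st_pad [x] 5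
  rw [e₂] at h₃
  rw [← e₃ (cd (a, b))]
  refine (Run.pop_true_st (cd a ++ cd b) (by simp) rfl
    (h₁.seq (h₂.seq (hr.seq h₃)))).mono ?_
  rw [size_pair]
  simp only [Polynomial.eval_add, Polynomial.eval_mul, Polynomial.eval_C, Polynomial.eval_X,
    length_cd] at *
  simp only [List.length_nil] at hd
  omega

end Poly

end StackProgram

/-! ### Folds over lists -/

namespace StackProgram

open Function Enc

namespace Poly

/-- Distribute `(s, (a, l))` from stack `0` to the stacks `3`, `1` and `0`, and raise a flag. -/
def foldStart : Prog :=
  .pop 0 .skip (.seq read (.seq (rev 4 3) (.pop 0 .skip (.seq read (.seq (rev 4 1)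
    (.push 2 true))) .skip))) .skip

/-- Move the first list element from stack `0`, and copies of the stacks `1` and `3`, into the
argument of the step function on stack `3`. -/
def foldArg : Prog :=
  .seq read (.seq (rev 4 3) (.seq (.push 3 true) (.seq (copy 1 4 5) (.seq (rev 4 3)
    (.seq (rev 5 1) (.push 3 true))))))

/-- The main loop of a fold. -/
def foldLoop (p : Prog) : Prog :=
  .loop 2 (.pop 0 .skip (.seq foldArg (.seq p.shift.shift.shift (.push 2 true))) .skip) .skip

/-- Move the result from stack `3` to stack `0`. -/
def foldFinish : Prog := .seq (clear 1) (.seq (rev 3 4) (rev 4 0))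

section

variable {α β γ : Type} [Enc α] [Enc β] [Enc γ]

theorem run_foldStart (s : γ) (a : α) (l : List β) :
    Run foldStart (st [cd (s, (a, l))]) (st [cd l, cd a, [true], cd s, [], []])
      (7 * size s + 7 * size a + 10) := by
  have e : st [cd (s, (a, l)), [], [], [], [], []] = st [cd (s, (a, l))] := st_pad [_] 5
  rw [← e]
  have h₁ : Run (rev 4 3) (st [cd (a, l), [], [], [], (cd s).reverse, []])
      (st [cd (a, l), [], [], cd s, [], []]) (2 * size s + 1) := by
    simpa [length_cd] using run_rev [cd (a, l), [], [], [], (cd s).reverse, []] 4 3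
  have h₂ : Run (rev 4 1) (st [cd l, [], [], cd s, (cd a).reverse, []])
      (st [cd l, cd a, [], cd s, [], []]) (2 * size a + 1) := by
    simpa [length_cd] using run_rev [cd l, [], [], cd s, (cd a).reverse, []] 4 1
  have h₃ : Run (.push 2 true) (st [cd l, cd a, [], cd s, [], []])
      (st [cd l, cd a, [true], cd s, [], []]) 1 :=
    Run.push_st [cd l, cd a, [], cd s, [], []] 2 true (by simp)
  have h₄ := run_read (enc a) (cd l) [] [] (cd s)
  have h₅ := run_read (enc s) (cd (a, l)) [] [] []
  refine (Run.pop_true_st (cd s ++ cd (a, l)) (by simp) rfl (h₅.seq (h₁.seq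
    (Run.pop_true_st (cd a ++ cd l) (by simp) rfl (h₄.seq (h₂.seq h₃)))))).mono ?_
  simp only [size, cd]
  omega

theorem run_foldArg (r : List Bool) (h : β) (a : α) (s : γ) :
    Run foldArg (st [cd h ++ r, cd a, [], cd s, [], []])
      (st [r, cd a, [], cd (a, h, s), [], []]) (7 * size h + 7 * size a + 8) := by
  have h₁ := run_read (enc h) r (cd a) [] (cd s)
  have h₂ : Run (rev 4 3) (st [r, cd a, [], cd s, (cd h).reverse, []])
      (st [r, cd a, [], cd h ++ cd s, [], []]) (2 * size h + 1) := by
    simpa [length_cd] using run_rev [r, cd a, [], cd s, (cd h).reverse, []] 4 3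
  have h₃ : Run (.push 3 true) (st [r, cd a, [], cd h ++ cd s, [], []])
      (st [r, cd a, [], cd (h, s), [], []]) 1 :=
    Run.push_st [r, cd a, [], cd h ++ cd s, [], []] 3 true (by simp)
  have h₄ : Run (copy 1 4 5) (st [r, cd a, [], cd (h, s), [], []])
      (st [r, [], [], cd (h, s), (cd a).reverse, (cd a).reverse]) (3 * size a + 1) := by
    simpa [length_cd] using run_copy [r, cd a, [], cd (h, s), [], []] 1 4 5
  have h₅ : Run (rev 4 3) (st [r, [], [], cd (h, s), (cd a).reverse, (cd a).reverse])
      (st [r, [], [], cd a ++ cd (h, s), [], (cd a).reverse]) (2 * size a + 1) := by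
    simpa [length_cd] using run_rev [r, [], [], cd (h, s), (cd a).reverse, (cd a).reverse] 4 3
  have h₆ : Run (rev 5 1) (st [r, [], [], cd a ++ cd (h, s), [], (cd a).reverse])
      (st [r, cd a, [], cd a ++ cd (h, s), [], []]) (2 * size a + 1) := by
    simpa [length_cd] using run_rev [r, [], [], cd a ++ cd (h, s), [], (cd a).reverse] 5 1
  have h₇ : Run (.push 3 true) (st [r, cd a, [], cd a ++ cd (h, s), [], []])
      (st [r, cd a, [], cd (a, h, s), [], []]) 1 :=
    Run.push_st [r, cd a, [], cd a ++ cd (h, s), [], []] 3 true (by simp)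
  refine (h₁.seq (h₂.seq (h₃.seq (h₄.seq (h₅.seq (h₆.seq h₇)))))).mono ?_
  simp only [size, cd]
  omega

theorem run_foldFinish (a : α) (s : γ) :
    Run foldFinish (st [[], cd a, [], cd s, [], []]) (st [cd s])
      (2 * size a + 4 * size s + 3) := by
  have e : st [cd s, [], [], [], [], []] = st [cd s] := st_pad [_] 5
  rw [← e]
  have h₁ : Run (clear 1) (st [[], cd a, [], cd s, [], []]) (st [[], [], [], cd s, [], []])
      (2 * size a + 1) := run_clear [[], cd a, [], cd s, [], []] 1 (by simp)
  have h₂ : Run (rev 3 4) (st [[], [], [], cd s, [], []])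
      (st [[], [], [], [], (cd s).reverse, []]) (2 * size s + 1) := by
    simpa [length_cd] using run_rev [[], [], [], cd s, [], []] 3 4
  have h₃ : Run (rev 4 0) (st [[], [], [], [], (cd s).reverse, []])
      (st [cd s, [], [], [], [], []]) (2 * size s + 1) := by
    simpa [length_cd] using run_rev [[], [], [], [], (cd s).reverse, []] 4 0
  exact (h₁.seq (h₂.seq h₃)).mono (by omega)

/-- The stacks `0`, `1`, `3` hold the remaining list, the parameter and the accumulator; `4` and `5`
are scratch. The flag on stack `2` starts a round, and the first symbol of the list code tells a
cons from the empty list, on which the flag is not renewed. Triple shifting lets the step program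
work on stack `3`. -/
theorem run_foldLoop {step : α → γ → β → γ} {p : Prog} {T : Polynomial ℕ}
    (hp : ∀ y : α × β × γ, Run p (st [cd y]) (st [cd (step y.1 y.2.2 y.2.1)]) (T.eval (size y)))
    (a : α) (n B : ℕ) (l : List β) : ∀ (s : γ), (∀ b ∈ l, size b + size a ≤ n) →
    (∀ l', l' <+: l → size (l'.foldl (step a) s) ≤ B) →
    Run (foldLoop p) (st [cd l, cd a, [true], cd s, [], []])
      (st [[], cd a, [], cd (l.foldl (step a) s), [], []])
      (l.length * (7 * n + 12 + T.eval (n + B + 2)) + 4) := by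
  induction l with
  | nil =>
    intro s _ _
    exact (Run.loop_true_st [] (by simp) rfl (Run.pop_false_st [] (by simp) rfl .skip)
      (.loop_nil rfl)).mono (by simp)
  | cons b l ih =>
    intro s hn hB
    have h₁ := run_foldArg (cd l) b a s
    have e : ∀ x, st [x, [], []] = st [x] := fun x => st_pad [x] 2
    have h₂ := hp (a, b, s)
    rw [← e, ← e] at h₂
    have h₃ := ((h₂.shift []).shift (cd a)).shift (cd l)
    have h₄ : Run (.push 2 true) (st [cd l, cd a, [], cd (step a s b), [], []])
        (st [cd l, cd a, [true], cd (step a s b), [], []]) 1 :=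
      Run.push_st [cd l, cd a, [], cd (step a s b), [], []] 2 true (by simp)
    have h₅ := ih (step a s b) (fun c hc => hn c (List.mem_cons_of_mem _ hc)) fun l' hl' => by
      have := hB (b :: l') (List.cons_prefix_cons.2 ⟨rfl, hl'⟩)
      simpa using this
    refine (Run.loop_true_st [] (by simp) rfl (Run.pop_true_st (cd b ++ cd l) (by simp) rfl
      (h₁.seq (h₃.seq h₄))) h₅).mono ?_
    have h₆ := hn b (by simp)
    have h₇ : size s ≤ B := hB [] (List.nil_prefix)
    have h₈ := eval_mono T (show size (a, b, s) ≤ n + B + 2 by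
      rw [size_pair, size_pair]; omega)
    rw [List.length_cons, Nat.add_mul, one_mul]
    omega

/-- A polynomial time step alone does not suffice, as the accumulator could, say, square its size in
each round. The hypothesis `hB` bounds the accumulators after all prefixes of the list. -/
theorem foldl {l : α → List β} {s : α → γ} {step : α → γ → β → γ} (hl : Poly l) (hs : Poly s)
    (hstep : Poly fun y : α × β × γ => step y.1 y.2.2 y.2.1) (B : Polynomial ℕ)
    (hB : ∀ a l', l' <+: l a → size (l'.foldl (step a) (s a)) ≤ B.eval (size a)) :
    Poly fun a => (l a).foldl (step a) (s a) := by
  obtain ⟨L, hL⟩ := hl.size_le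
  obtain ⟨q, U, hq⟩ := hs.pair (Poly.id.pair hl)
  obtain ⟨p, T, hp⟩ := hstep
  refine ⟨.seq q (.seq foldStart (.seq (foldLoop p) foldFinish)),
    U + (.C 11 * B + .C 16 * .X + .C 40) +
      L * (.C 7 * (L + .X) + .C 12 + T.comp (L + .X + B + .C 2)), fun a => ?_⟩
  have h₁ := hB a [] List.nil_prefix
  have h₂ := hB a (l a) List.prefix_rfl
  have h₃ := run_foldLoop hp a (L.eval (size a) + size a) (B.eval (size a)) (l a) (s a)
    (fun b hb => by have := size_le_of_mem hb; have := hL a; omega) (hB a)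
  refine ((hq a).seq ((run_foldStart (s a) a (l a)).seq (h₃.seq (run_foldFinish a _)))).mono ?_
  have h₄ := Nat.mul_le_mul_right (7 * (L.eval (size a) + size a) + 12 +
    T.eval (L.eval (size a) + size a + B.eval (size a) + 2))
    ((length_le_size (l a)).trans (hL a))
  simp only [Polynomial.eval_add, Polynomial.eval_mul, Polynomial.eval_C, Polynomial.eval_X,
    Polynomial.eval_comp]
  simp only [List.foldl_nil] at h₁
  omega

end

/-! ### Closure properties -/

section

variable {α β γ : Type} [Enc α] [Enc β] [Enc γ]

theorem fst {f : α → β × γ} (hf : Poly f) : Poly fun a => (f a).1 :=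
  (left (f := Prod.fst) fun _ => rfl).comp hf

theorem snd {f : α → β × γ} (hf : Poly f) : Poly fun a => (f a).2 :=
  (right (f := Prod.snd) fun _ => rfl).comp hf

theorem and {f g : α → Bool} (hf : Poly f) (hg : Poly g) : Poly fun a => f a && g a :=
  (hf.ite hg (const false)).of_eq fun a => by cases f a <;> rfl

theorem or {f g : α → Bool} (hf : Poly f) (hg : Poly g) : Poly fun a => f a || g a :=
  (hf.ite (const true) hg).of_eq fun a => by cases f a <;> rfl

theorem not {f : α → Bool} (hf : Poly f) : Poly fun a => !f a :=
  (hf.ite (const false) (const true)).of_eq fun a => by cases f a <;> rfl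

theorem eq [DecidableEq β] {f g : α → β} (hf : Poly f) (hg : Poly g) :
    Poly fun a => decide (f a = g a) :=
  eq_pair.comp (hf.pair hg)

theorem cons {f : α → β} {g : α → List β} (hf : Poly f) (hg : Poly g) :
    Poly fun a => f a :: g a :=
  (hf.pair hg).of_enc fun _ => rfl

theorem tail {f : α → List β} (hf : Poly f) : Poly fun a => (f a).tail :=
  (right (f := List.tail) fun l => by cases l <;> rfl).comp hf

/-- The empty list is a leaf, whose left subtree is a leaf; the default must therefore have this
code, as `0 : ℕ` does. -/
theorem headD {f : α → List β} {b : β} (hb : enc b = .leaf) (hf : Poly f) :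
    Poly fun a => (f a).headD b :=
  (left (f := fun l => l.headD b) fun l => by cases l with
    | nil => exact hb
    | cons => rfl).comp hf

theorem any {l : α → List β} {p : α → β → Bool} (hl : Poly l)
    (hp : Poly fun y : α × β => p y.1 y.2) : Poly fun a => (l a).any (p a) := by
  have h := foldl (step := fun a s b => s || p a b) hl (const false)
    (id.snd.snd.or (hp.comp (id.fst.pair id.snd.fst))) (.C 3) fun a l' _ => by
      rw [Polynomial.eval_C]; exact size_bool_le _
  refine h.of_eq fun a => ?_
  have key : ∀ (l : List β) (s : Bool), l.foldl (fun s b => s || p a b) s = (s || l.any (p a)) := by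
    intro l
    induction l with
    | nil => simp
    | cons b l ih => intro s; rw [List.foldl_cons, ih, List.any_cons, Bool.or_assoc]
  rw [key, Bool.false_or]

theorem all {l : α → List β} {p : α → β → Bool} (hl : Poly l)
    (hp : Poly fun y : α × β => p y.1 y.2) : Poly fun a => (l a).all (p a) :=
  (hl.any (p := fun a b => !p a b) hp.not).not.of_eq fun a => by
    rw [List.all_eq_not_any_not]

theorem mem [DecidableEq β] {f : α → β} {l : α → List β} {_ : ∀ a, Decidable (f a ∈ l a)}
    (hf : Poly f) (hl : Poly l) : Poly fun a => decide (f a ∈ l a) :=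
  (hl.any (p := fun a b => decide (f a = b)) ((hf.comp id.fst).eq id.snd)).of_eq fun a => by
    rw [Bool.eq_iff_iff]; simp

theorem reverse {l : α → List β} (hl : Poly l) : Poly fun a => (l a).reverse := by
  obtain ⟨L, hL⟩ := hl.size_le
  have key : ∀ (l s : List β), l.foldl (fun s b => b :: s) s = l.reverse ++ s := by
    intro l
    induction l with
    | nil => simp
    | cons b l ih => intro s; rw [List.foldl_cons, ih, List.reverse_cons]; simp
  have h := foldl (step := fun _ s b => b :: s) hl (const ([] : List β))
    (id.snd.fst.cons id.snd.snd) L fun a l' hl' => by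
      rw [key, List.append_nil, size_reverse]
      exact (size_le_of_sublist hl'.sublist).trans (hL a)
  exact h.of_eq fun a => by rw [key, List.append_nil]

theorem append {l m : α → List β} (hl : Poly l) (hm : Poly m) : Poly fun a => l a ++ m a := by
  obtain ⟨L, hL⟩ := hl.size_le
  obtain ⟨M, hM⟩ := hm.size_le
  have key : ∀ (l s : List β), l.foldl (fun s b => b :: s) s = l.reverse ++ s := by
    intro l
    induction l with
    | nil => simp
    | cons b l ih => intro s; rw [List.foldl_cons, ih, List.reverse_cons]; simp
  have h := foldl (step := fun _ s b => b :: s) hl.reverse hm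
    (id.snd.fst.cons id.snd.snd) (L + M) fun a l' hl' => by
      rw [key, Polynomial.eval_add]
      have h₁ := size_le_of_sublist hl'.sublist
      have h₂ := size_append l'.reverse (m a)
      rw [size_reverse] at h₁ h₂
      have := hL a
      have := hM a
      omega
  exact h.of_eq fun a => by rw [key, List.reverse_reverse]

theorem flatMap {l : α → List β} {f : α → β → List γ} (hl : Poly l)
    (hf : Poly fun y : α × β => f y.1 y.2) : Poly fun a => (l a).flatMap (f a) := by
  obtain ⟨L, hL⟩ := hl.size_le
  obtain ⟨F, hF⟩ := hf.size_le
  have key : ∀ a (l : List β) (s : List γ),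
      l.foldl (fun s b => s ++ f a b) s = s ++ l.flatMap (f a) := by
    intro a l
    induction l with
    | nil => simp
    | cons b l ih => intro s; rw [List.foldl_cons, ih, List.flatMap_cons]; simp
  have h := foldl (step := fun a s b => s ++ f a b) hl (const ([] : List γ))
    (id.snd.snd.append (hf.comp (id.fst.pair id.snd.fst)))
    -- At most `L` elements are visited, and each contributes at most `F` of the size of a pair `(a,
    -- b)` with `b` in the list.
    (L * F.comp (.X + L + .C 1) + .C 1) fun a l' hl' => by
      rw [key, List.nil_append]
      have hsz : ∀ l' : List β, (∀ b ∈ l', b ∈ l a) → size (l'.flatMap (f a)) ≤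
          l'.length * F.eval (size a + L.eval (size a) + 1) + 1 := by
        intro l'
        induction l' with
        | nil => simp [size_nil]
        | cons b l' ih =>
          intro h
          have h₁ := ih fun c hc => h c (List.mem_cons_of_mem _ hc)
          have h₂ := size_le_of_mem (h b (by simp))
          have h₃ := hF (a, b)
          have h₄ := hL a
          have h₅ := eval_mono F (show size (a, b) ≤ size a + L.eval (size a) + 1 by
            rw [size_pair]; omega)
          have h₆ := size_append (f a b) (l'.flatMap (f a))
          rw [List.flatMap_cons, List.length_cons, Nat.add_mul, one_mul]
          simp only at h₃
          omega
      refine (hsz l' fun b hb => hl'.subset hb).trans ?_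
      simp only [Polynomial.eval_add, Polynomial.eval_mul, Polynomial.eval_C, Polynomial.eval_X,
        Polynomial.eval_comp]
      gcongr
      exact hl'.length_le.trans ((length_le_size _).trans (hL a))
  exact h.of_eq fun a => by rw [key, List.nil_append]

theorem map {l : α → List β} {f : α → β → γ} (hl : Poly l)
    (hf : Poly fun y : α × β => f y.1 y.2) : Poly fun a => (l a).map (f a) :=
  (hl.flatMap (f := fun a b => [f a b]) (hf.cons (const []))).of_eq fun a => by
    rw [List.map_eq_flatMap]

theorem filter {l : α → List β} {p : α → β → Bool} (hl : Poly l)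
    (hp : Poly fun y : α × β => p y.1 y.2) : Poly fun a => (l a).filter (p a) := by
  refine (hl.flatMap (f := fun a b => bif p a b then [b] else [])
    (hp.ite (id.snd.cons (const [])) (const []))).of_eq fun a => ?_
  induction l a with
  | nil => rfl
  | cons b l ih =>
    rw [List.flatMap_cons, List.filter_cons, ← ih]
    cases p a b <;> rfl

end

end Poly

/-! ### From programs to Turing machines -/

/-- A polynomial time decision procedure for reversed words yields a Turing machine. -/
theorem nonempty_computableInPolyTime {α A : Type} [Fintype A] [Enc A] (ea : α → List A)
    (f : α → Bool) {g : List A → Bool} (hg : Poly g) (h : ∀ x, g (ea x).reverse = f x) :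
    Nonempty (Turing.TM2ComputableInPolyTime ea Computability.encodeBool f) := by
  obtain ⟨p, T, hp⟩ := hg
  obtain ⟨n, hn⟩ := p.exists_bounded
  -- The alphabet is finite, so one constant bounds all symbol codes, and the code of a word is
  -- linear in its length.
  obtain ⟨C, hC⟩ : ∃ C, ∀ a : A, size a + 1 ≤ C := by
    refine ⟨∑ a : A, (size a + 1), fun a => ?_⟩
    exact Finset.single_le_sum (f := fun a : A => size a + 1) (fun _ _ => Nat.zero_le _)
      (Finset.mem_univ a)
  -- A prefix `true` makes each symbol code a cons cell, and the bottom symbol `false` is the empty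
  -- list; so stack `0` holds precisely the code of a list.
  have hcode : ∀ w : List A, w.flatMap (fun a => true :: cd a) ++ [false] = cd w := by
    intro w
    induction w with
    | nil => rfl
    | cons a w ih => rw [List.flatMap_cons, List.append_assoc, ih, cd_cons]; rfl
  have hsize : ∀ w : List A, size w ≤ C * w.length + 1 := by
    intro w
    induction w with
    | nil => simp [size_nil]
    | cons a w ih =>
      have := hC a
      rw [size_cons, List.length_cons, Nat.mul_add]
      omega
  refine ⟨⟨⟨machine A (fun a => true :: cd a) n p, Equiv.refl A, Equiv.refl Bool⟩,
    .C 2 * .X + T.comp (.C C * .X + .C 1) + .C 3, fun x => ?_⟩⟩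
  have hrun := hp (ea x).reverse
  rw [h x, ← hcode] at hrun
  have hb : cd (f x) = if f x then [true, false, false] else [false] := by
    cases f x <;> rfl
  rw [hb] at hrun
  have key := Classical.choice (reach_machine (fun a : A => true :: cd a) hn hrun)
  have e : List.map (Equiv.refl A).invFun (ea x) = ea x := List.map_id _
  have hle : 2 * (ea x).length + T.eval (size (ea x).reverse) + 3 ≤
      (Polynomial.C 2 * Polynomial.X + T.comp (Polynomial.C C * Polynomial.X + Polynomial.C 1) +
        Polynomial.C 3).eval (ea x).length := by
    have := eval_mono T (hsize (ea x).reverse)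
    rw [List.length_reverse] at this
    simp only [Polynomial.eval_add, Polynomial.eval_mul, Polynomial.eval_C, Polynomial.eval_X,
      Polynomial.eval_comp]
    omega
  refine cast ?_ (⟨key.toEvalsTo, key.steps_le_m.trans hle⟩ :
    Turing.TM2OutputsInTime (machine A (fun a : A => true :: cd a) n p) (ea x) (some [f x]) _)
  exact congrArg (fun w => Turing.TM2OutputsInTime (machine A (fun a : A => true :: cd a) n p) w
    (some [f x]) _) e.symm

end StackProgram

/-! ### Encodings of the input -/

namespace StackProgram

open Enc

theorem foldr_bit_bits (n : ℕ) : n.bits.foldr Nat.bit 0 = n := by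
  induction n using Nat.binaryRec' with
  | zero => simp
  | bit b n h ih => rw [Nat.bits_append_bit n b h, List.foldr_cons, ih]

/-- Digits are written least significant first, so a reader that goes from right to left recovers
the number by repeated `Nat.bit`. -/
theorem foldr_bit_encodeNat (n : ℕ) : (Computability.encodeNat n).foldr Nat.bit 0 = n := by
  have key : ∀ p : PosNum, (Computability.encodePosNum p).foldr Nat.bit 0 = (p : ℕ) := by
    intro p
    induction p with
    | one => rfl
    | bit1 p ih =>
      rw [Computability.encodePosNum, List.foldr_cons, ih, PosNum.cast_bit1]
      change 2 * (p : ℕ) + 1 = _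
      omega
    | bit0 p ih =>
      rw [Computability.encodePosNum, List.foldr_cons, ih, PosNum.cast_bit0]
      change 2 * (p : ℕ) = _
      omega
  have key' : ∀ m : Num, (Computability.encodeNum m).foldr Nat.bit 0 = (m : ℕ) := by
    intro m
    cases m with
    | zero => rfl
    | pos p => exact key p
  exact (key' n).trans (Num.to_of_nat n)

instance : Enc ℕ where
  enc n := enc n.bits
  enc_injective := fun m n h => by
    rw [← foldr_bit_bits m, ← foldr_bit_bits n, enc_injective h]

open DLLite

/-- The index of a symbol. -/
def symIndex : Sym → ℕ
  | .bit false => 0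
  | .bit true => 1
  | .arg => 2
  | .subConcept => 3
  | .subExists => 4
  | .existsSub => 5
  | .subRole => 6
  | .subInverse => 7
  | .disjConcept => 8
  | .disjRole => 9
  | .cri => 10
  | .assertConcept => 11
  | .assertRole => 12
  | .ordName => 13
  | .ordInv => 14
  | .ordMember => 15
  | .ordPrec => 16

instance : Enc Sym where
  enc s := enc (symIndex s)
  enc_injective := fun s s' h => by
    have h' : symIndex s = symIndex s' := enc_injective h
    clear h
    revert s s'
    decide

/-- The components of an element. -/
def elemTuple : Elem → ℕ × ℕ × ℕ
  | .ind a => (0, a, 0)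
  | .filler a r => (1, a, r)
  | .shared r => (2, 0, r)

instance : Enc Elem where
  enc d := enc (elemTuple d)
  enc_injective := fun d d' h => by
    have h' := enc_injective h
    cases d <;> cases d' <;> simp_all [elemTuple]

end StackProgram

namespace DLLite

/-- The first element of a fact. -/
def Fact.src : Fact → Elem
  | .concept _ d => d
  | .role _ d _ => d

/-- The last element of a fact. -/
def Fact.tgt : Fact → Elem
  | .concept _ d => d
  | .role _ _ e => e

/-- The element that witnesses `∃ r` at an element. -/
def Elem.next (r : RoleName) : Elem → Elem
  | .ind a => .filler a r
  | _ => .shared r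

end DLLite

namespace StackProgram

open DLLite Enc

/-- The components of a fact. -/
def factTuple : Fact → ℕ × ℕ × Elem × Elem
  -- The element is repeated so that `src` and `tgt` are projections for both kinds of facts.
  | .concept A d => (0, A, d, d)
  | .role r d e => (1, r, d, e)

instance : Enc Fact where
  enc u := enc (factTuple u)
  enc_injective := fun u u' h => by
    have h' := enc_injective h
    cases u <;> cases u' <;> simp_all [factTuple]

/-- One more digit is one more list cell, of size at most `3 + 1`. The exception is `Nat.bit false 0
= 0`, which has no digit. -/
theorem size_bit_le (b : Bool) (n : ℕ) : size (Nat.bit b n) ≤ size n + 4 := by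
  by_cases h : n = 0 → b = true
  · have : size (Nat.bit b n) = size (b :: n.bits) :=
      congrArg (fun l : List Bool => size l) (Nat.bits_append_bit n b h)
    rw [this, size_cons]
    have := size_bool_le b
    change _ ≤ size n.bits + 4
    omega
  · push Not at h
    obtain ⟨rfl, hb⟩ := h
    obtain rfl : b = false := by simpa using hb
    simp [Nat.bit]

theorem size_le_size_of_headD (l : List ℕ) : size (l.headD 0) ≤ size l := by
  cases l with
  | nil => exact le_of_eq (by rw [size_nil]; rfl)
  | cons a l => rw [size_cons]; simp only [List.headD_cons]; omega

/-! ### Polynomial time operations on numbers, elements and facts -/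

namespace Poly

variable {α β γ : Type} [Enc α] [Enc β] [Enc γ]

/-- `Nat.bits` has no leading zeros, so a digit may be consed onto the list except when a zero digit
is added to `0`. -/
theorem bit {b : α → Bool} {n : α → ℕ} (hb : Poly b) (hn : Poly n) :
    Poly fun a => Nat.bit (b a) (n a) := by
  have hbits : Poly fun a => (n a).bits := hn.of_enc fun _ => rfl
  refine ((((hn.eq (const 0)).and hb.not).ite (const [])
    (hb.cons hbits)).of_enc (f := fun a => Nat.bit (b a) (n a)) fun a => ?_)
  change enc (Nat.bit (b a) (n a)).bits = _
  congr 1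
  by_cases h : n a = 0 → b a = true
  · rw [Nat.bits_append_bit _ _ h]
    by_cases h0 : n a = 0
    · simp [h0, h h0]
    · simp [h0]
  · push Not at h
    simp [h.1, h.2]

theorem ind {f : α → ℕ} (hf : Poly f) : Poly fun x => Elem.ind (f x) :=
  ((const 0).pair (hf.pair (const 0))).of_enc fun _ => rfl

theorem filler {f g : α → ℕ} (hf : Poly f) (hg : Poly g) : Poly fun x => Elem.filler (f x) (g x) :=
  ((const 1).pair (hf.pair hg)).of_enc fun _ => rfl

theorem shared {f : α → ℕ} (hf : Poly f) : Poly fun x => Elem.shared (f x) :=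
  ((const 2).pair ((const 0).pair hf)).of_enc fun _ => rfl

theorem next {r : α → ℕ} {d : α → Elem} (hr : Poly r) (hd : Poly d) :
    Poly fun x => (d x).next (r x) := by
  have ht : Poly fun x => elemTuple (d x) := hd.of_enc fun _ => rfl
  refine ((ht.fst.eq (const 0)).ite (ht.snd.fst.filler hr) hr.shared).of_eq fun x => ?_
  cases d x <;> rfl

theorem concept {A : α → ℕ} {d : α → Elem} (hA : Poly A) (hd : Poly d) :
    Poly fun x => Fact.concept (A x) (d x) :=
  ((const 0).pair (hA.pair (hd.pair hd))).of_enc fun _ => rfl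

theorem role {r : α → ℕ} {d e : α → Elem} (hr : Poly r) (hd : Poly d) (he : Poly e) :
    Poly fun x => Fact.role (r x) (d x) (e x) :=
  ((const 1).pair (hr.pair (hd.pair he))).of_enc fun _ => rfl

theorem src {u : α → Fact} (hu : Poly u) : Poly fun x => (u x).src := by
  have ht : Poly fun x => factTuple (u x) := hu.of_enc fun _ => rfl
  exact ht.snd.snd.fst.of_eq fun x => by cases u x <;> rfl

theorem tgt {u : α → Fact} (hu : Poly u) : Poly fun x => (u x).tgt := by
  have ht : Poly fun x => factTuple (u x) := hu.of_enc fun _ => rfl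
  exact ht.snd.snd.snd.of_eq fun x => by cases u x <;> rfl

/-- Folds whose accumulator grows linearly. -/
theorem foldl_of_linear {l : α → List β} {s : α → γ} {step : α → γ → β → γ} (hl : Poly l)
    (hs : Poly s) (hstep : Poly fun y : α × β × γ => step y.1 y.2.2 y.2.1) (K : ℕ)
    (hK : ∀ a s b, size (step a s b) ≤ size s + K * (size b + 1)) :
    Poly fun a => (l a).foldl (step a) (s a) := by
  obtain ⟨L, hL⟩ := hl.size_le
  obtain ⟨S, hS⟩ := hs.size_le
  refine foldl hl hs hstep (S + .C K * L) fun a l' hl' => ?_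
  have key : ∀ (l' : List β) (s : γ), size (l'.foldl (step a) s) ≤ size s + K * size l' := by
    intro l'
    induction l' with
    | nil => intro s; simp
    | cons b l' ih =>
      intro s
      have h₁ := ih (step a s b)
      have h₂ := hK a s b
      rw [List.foldl_cons, size_cons]
      nlinarith
  refine (key l' (s a)).trans ?_
  simp only [Polynomial.eval_add, Polynomial.eval_mul, Polynomial.eval_C]
  gcongr
  · exact hS a
  · exact (size_le_of_sublist hl'.sublist).trans (hL a)

end Poly

end StackProgram

/-! ### The decision procedure -/

namespace DLLite

/-- A keyword with the names that follow it. -/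
abbrev Item := Sym × List ℕ

namespace Item

/-- The first name. -/
def fst (it : Item) : ℕ := it.2.headD 0

/-- The second name. -/
def snd (it : Item) : ℕ := it.2.tail.headD 0

/-- The third name. -/
def thd (it : Item) : ℕ := it.2.tail.tail.headD 0

/-- The item is an assertion that states the fact `u`. -/
def asserts (it : Item) (u : Fact) : Bool :=
  (decide (it.1 = .assertConcept) && decide (u = .concept it.fst (.ind it.snd))) ||
  (decide (it.1 = .assertRole) && decide (u = .role it.fst (.ind it.snd) (.ind it.thd)))

/-- The item is an axiom that derives the fact `u` from the facts `φ` and `ψ`. -/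
def derives (it : Item) (φ ψ u : Fact) : Bool :=
  (decide (it.1 = .subConcept) && (decide (φ = .concept it.fst φ.src) &&
    decide (u = .concept it.snd φ.src))) ||
  ((decide (it.1 = .subExists) && (decide (φ = .concept it.fst φ.src) &&
    decide (u = .role it.snd φ.src (φ.src.next it.snd)))) ||
  ((decide (it.1 = .existsSub) && (decide (φ = .role it.fst φ.src φ.tgt) &&
    decide (u = .concept it.snd φ.src))) ||
  ((decide (it.1 = .subRole) && (decide (φ = .role it.fst φ.src φ.tgt) &&
    decide (u = .role it.snd φ.src φ.tgt))) ||
  ((decide (it.1 = .subInverse) && (decide (φ = .role it.fst φ.src φ.tgt) &&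
    decide (u = .role it.snd φ.tgt φ.src))) ||
  (decide (it.1 = .cri) && (decide (φ = .role it.fst φ.src φ.tgt) &&
    (decide (ψ = .role it.snd φ.tgt ψ.tgt) && decide (u = .role it.thd φ.src ψ.tgt))))))))

end Item

/-- One step of the parser, which reads a string from right to left, and keeps the current name,
the completed names since the last keyword, and the completed items. -/
def parseStep (st : ℕ × List ℕ × List Item) (s : Sym) : ℕ × List ℕ × List Item :=
  bif decide (s = .bit false) then (Nat.bit false st.1, st.2)
  else bif decide (s = .bit true) then (Nat.bit true st.1, st.2)
  else bif decide (s = .arg) then (0, st.1 :: st.2.1, st.2.2)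
  else (0, [], (s, st.2.1) :: st.2.2)

/-- The items of a reversed string. -/
def parse (w : List Sym) : List Item := (w.foldl parseStep (0, [], [])).2.2

/-- The names in the items. -/
def itemNames (its : List Item) : List ℕ := its.flatMap fun it => it.2

/-- A list that contains the elements of the small model. -/
def allElems (its : List Item) : List Elem :=
  (itemNames its).map Elem.ind ++ ((itemNames its).map Elem.shared ++
    (itemNames its).flatMap fun a => (itemNames its).map (Elem.filler a))

/-- A list that contains the facts of the small model. -/
def allFacts (its : List Item) : List Fact :=
  ((itemNames its).flatMap fun A => (allElems its).map (Fact.concept A)) ++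
    (itemNames its).flatMap fun r => (allElems its).flatMap fun d =>
      (allElems its).map (Fact.role r d)

/-- The fact `u` is derivable in one step from the facts in `F`. -/
def derivable (its : List Item) (F : List Fact) (u : Fact) : Bool :=
  its.any (fun it => it.asserts u) ||
    its.any fun it => F.any fun φ => F.any fun ψ => it.derives φ ψ u

/-- The facts of the small model. -/
def saturate (its : List Item) : List Fact :=
  -- The list that is folded over serves only to count the rounds.
  (allFacts its).foldl (fun F _ => (allFacts its).filter (derivable its F)) []

/-- The condition of an order constraint on a pair of elements. -/
def pairCheck (F : List Fact) (mem : List ℕ) (prec : List (ℕ × ℕ)) (d e : Elem) : Bool :=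
  mem.any (fun A => decide (Fact.concept A d ∈ F)) &&
  (mem.any (fun A => decide (Fact.concept A e ∈ F)) &&
  mem.all fun A => mem.all fun B =>
    !(decide (Fact.concept A d ∈ F) && decide (Fact.concept B e ∈ F)) ||
      decide ((A, B) ∈ prec))

/-- The check of an order constraint on a role name `p`. -/
def nameCheck (F : List Fact) (mem : List ℕ) (prec : List (ℕ × ℕ)) (p : ℕ) : Bool :=
  F.all fun u => !decide (u = .role p u.src u.tgt) || pairCheck F mem prec u.src u.tgt

/-- The check of an order constraint on an inverse role `p⁻`. -/
def invCheck (F : List Fact) (mem : List ℕ) (prec : List (ℕ × ℕ)) (p : ℕ) : Bool :=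
  F.all fun u => !decide (u = .role p u.src u.tgt) || pairCheck F mem prec u.tgt u.src

/-- One step of the check of the order constraints, which reads the items from right to left, and
keeps the concepts and the pairs of the current order constraint, and the result so far. -/
def constraintStep (F : List Fact) (st : List ℕ × List (ℕ × ℕ) × Bool) (it : Item) :
    List ℕ × List (ℕ × ℕ) × Bool :=
  bif decide (it.1 = .ordPrec) then (st.1, (it.fst, it.snd) :: st.2.1, st.2.2)
  else bif decide (it.1 = .ordMember) then (it.fst :: st.1, st.2.1, st.2.2)
  else bif decide (it.1 = .ordName) then
    ([], [], nameCheck F st.1 st.2.1 it.fst && st.2.2)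
  else bif decide (it.1 = .ordInv) then
    ([], [], invCheck F st.1 st.2.1 it.fst && st.2.2)
  else st

/-- The decision procedure, on reversed strings. -/
def decideAdmissible (w : List Sym) : Bool :=
  ((parse w).reverse.foldl (constraintStep (saturate (parse w))) ([], [], true)).2.2

end DLLite

/-! ### Polynomial time bounds for the decision procedure -/

namespace StackProgram.Poly

open DLLite Enc

variable {α : Type} [Enc α]

section

variable {it : α → Item} {φ ψ u : α → Fact}

theorem itemFst (h : Poly it) : Poly fun x => (it x).fst := h.snd.headD rfl

theorem itemSnd (h : Poly it) : Poly fun x => (it x).snd := h.snd.tail.headD rfl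

theorem itemThd (h : Poly it) : Poly fun x => (it x).thd := h.snd.tail.tail.headD rfl

theorem hasTag (h : Poly it) (s : Sym) : Poly fun x => decide ((it x).1 = s) := h.fst.eq (const s)

theorem asserts (h : Poly it) (hu : Poly u) : Poly fun x => (it x).asserts (u x) :=
  ((h.hasTag _).and (hu.eq (h.itemFst.concept h.itemSnd.ind))).or
    ((h.hasTag _).and (hu.eq (h.itemFst.role h.itemSnd.ind h.itemThd.ind)))

theorem derives (h : Poly it) (hφ : Poly φ) (hψ : Poly ψ) (hu : Poly u) :
    Poly fun x => (it x).derives (φ x) (ψ x) (u x) :=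
  have hc := hφ.eq (h.itemFst.concept hφ.src)
  have hr := hφ.eq (h.itemFst.role hφ.src hφ.tgt)
  ((h.hasTag _).and (hc.and (hu.eq (h.itemSnd.concept hφ.src)))).or <|
  ((h.hasTag _).and (hc.and (hu.eq (h.itemSnd.role hφ.src (h.itemSnd.next hφ.src))))).or <|
  ((h.hasTag _).and (hr.and (hu.eq (h.itemSnd.concept hφ.src)))).or <|
  ((h.hasTag _).and (hr.and (hu.eq (h.itemSnd.role hφ.src hφ.tgt)))).or <|
  ((h.hasTag _).and (hr.and (hu.eq (h.itemSnd.role hφ.tgt hφ.src)))).or <|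
  (h.hasTag _).and (hr.and ((hψ.eq (h.itemSnd.role hφ.tgt hψ.tgt)).and
    (hu.eq (h.itemThd.role hφ.src hψ.tgt))))

end

theorem parse : Poly DLLite.parse := by
  have hst : Poly fun y : List Sym × Sym × (ℕ × List ℕ × List Item) => y.2.2 := id.snd.snd
  have hs : Poly fun y : List Sym × Sym × (ℕ × List ℕ × List Item) => y.2.1 := id.snd.fst
  have hstep : Poly fun y : List Sym × Sym × (ℕ × List ℕ × List Item) =>
      parseStep y.2.2 y.2.1 :=
    (hs.eq (const _)).ite (((const false).bit hst.fst).pair hst.snd) <|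
    (hs.eq (const _)).ite (((const true).bit hst.fst).pair hst.snd) <|
    (hs.eq (const _)).ite ((const 0).pair ((hst.fst.cons hst.snd.fst).pair hst.snd.snd)) <|
    (const 0).pair ((const []).pair ((hs.pair hst.snd.fst).cons hst.snd.snd))
  -- A digit adds at most 4 by `size_bit_le`; the other symbols move data and add a few cells and at
  -- most one symbol code.
  refine (foldl_of_linear (step := fun _ => parseStep) id (const (0, [], [])) hstep 4
    fun _ s b => ?_).snd.snd
  obtain ⟨cur, words, its⟩ := s
  have h0 : size (0 : ℕ) = 1 := rfl
  have hb := size_pos b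
  have hc := size_pos cur
  have h₁ := size_bit_le false cur
  have h₂ := size_bit_le true cur
  unfold parseStep
  cases decide (b = .bit false) <;> cases decide (b = .bit true) <;> cases decide (b = .arg) <;>
    simp only [cond_true, cond_false, size_pair, size_cons, size_nil, h0] <;> omega

section

variable {its : α → List Item}

theorem itemNames (h : Poly its) : Poly fun x => itemNames (its x) :=
  h.flatMap (f := fun _ (it : Item) => it.2) id.snd.snd

theorem allElems (h : Poly its) : Poly fun x => allElems (its x) :=
  (h.itemNames.map (f := fun _ => Elem.ind) id.snd.ind).append <|
  (h.itemNames.map (f := fun _ => Elem.shared) id.snd.shared).append <|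
  h.itemNames.flatMap (f := fun x a => (DLLite.itemNames (its x)).map (Elem.filler a)) <|
  (h.itemNames.comp id.fst).map (f := fun (y : α × ℕ) => Elem.filler y.2)
    (id.fst.snd.filler id.snd)

theorem allFacts (h : Poly its) : Poly fun x => allFacts (its x) :=
  (h.itemNames.flatMap (f := fun x A => (DLLite.allElems (its x)).map (Fact.concept A)) <|
    (h.allElems.comp id.fst).map (f := fun (y : α × ℕ) => Fact.concept y.2)
      (id.fst.snd.concept id.snd)).append <|
  h.itemNames.flatMap (f := fun x r => (DLLite.allElems (its x)).flatMap fun d =>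
    (DLLite.allElems (its x)).map (Fact.role r d)) <|
  (h.allElems.comp id.fst).flatMap (f := fun (y : α × ℕ) d =>
    (DLLite.allElems (its y.1)).map (Fact.role y.2 d)) <|
  (h.allElems.comp id.fst.fst).map (f := fun (y : (α × ℕ) × Elem) => Fact.role y.1.2 y.2)
    (id.fst.fst.snd.role id.fst.snd id.snd)

theorem derivable {F : α → List Fact} {u : α → Fact} (h : Poly its) (hF : Poly F) (hu : Poly u) :
    Poly fun x => derivable (its x) (F x) (u x) :=
  (h.any (p := fun x (it : Item) => it.asserts (u x)) (id.snd.asserts (hu.comp id.fst))).or <|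
  h.any (p := fun x (it : Item) => (F x).any fun φ => (F x).any fun ψ => it.derives φ ψ (u x)) <|
  (hF.comp id.fst).any (p := fun (y : α × Item) φ => (F y.1).any fun ψ =>
    y.2.derives φ ψ (u y.1)) <|
  (hF.comp id.fst.fst).any (p := fun (y : (α × Item) × Fact) ψ =>
    y.1.2.derives y.2 ψ (u y.1.1)) <|
  id.fst.fst.snd.derives id.fst.snd id.snd (hu.comp id.fst.fst.fst)

end

/-- Each accumulator is empty or a filtered copy of the candidate list, so it never outgrows that
list. -/
theorem saturate : Poly DLLite.saturate := by
  have hU : Poly fun its : List Item => DLLite.allFacts its := id.allFacts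
  obtain ⟨L, hL⟩ := hU.size_le
  refine foldl (step := fun its F _ => (DLLite.allFacts its).filter (DLLite.derivable its F))
    hU (const []) ?_ L fun its l' _ => ?_
  · exact (hU.comp id.fst).filter (p := fun (y : List Item × Fact × List Fact) u =>
      DLLite.derivable y.1 y.2.2 u) (id.fst.fst.derivable id.fst.snd.snd id.snd)
  · refine le_trans ?_ (hL its)
    rcases List.eq_nil_or_concat l' with rfl | ⟨l', b, rfl⟩
    · exact size_le_of_sublist (List.nil_sublist _)
    · rw [List.concat_eq_append, List.foldl_concat]
      exact size_le_of_sublist List.filter_sublist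

section

variable {F : α → List Fact} {mem : α → List ℕ} {prec : α → List (ℕ × ℕ)}

theorem pairCheck {d e : α → Elem} (hF : Poly F) (hm : Poly mem) (hp : Poly prec) (hd : Poly d)
    (he : Poly e) : Poly fun x => pairCheck (F x) (mem x) (prec x) (d x) (e x) :=
  (hm.any (p := fun x A => decide (Fact.concept A (d x) ∈ F x))
    ((id.snd.concept (hd.comp id.fst)).mem (hF.comp id.fst))).and <|
  (hm.any (p := fun x A => decide (Fact.concept A (e x) ∈ F x))
    ((id.snd.concept (he.comp id.fst)).mem (hF.comp id.fst))).and <|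
  hm.all (p := fun x A => (mem x).all fun B =>
    !(decide (Fact.concept A (d x) ∈ F x) && decide (Fact.concept B (e x) ∈ F x)) ||
      decide ((A, B) ∈ prec x)) <|
  (hm.comp id.fst).all (p := fun (y : α × ℕ) B =>
    !(decide (Fact.concept y.2 (d y.1) ∈ F y.1) && decide (Fact.concept B (e y.1) ∈ F y.1)) ||
      decide ((y.2, B) ∈ prec y.1)) <|
  ((((id.fst.snd.concept (hd.comp id.fst.fst)).mem (hF.comp id.fst.fst)).and
    ((id.snd.concept (he.comp id.fst.fst)).mem (hF.comp id.fst.fst))).not.or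
    ((id.fst.snd.pair id.snd).mem (hp.comp id.fst.fst)))

theorem nameCheck {p : α → ℕ} (hF : Poly F) (hm : Poly mem) (hp : Poly prec) (hr : Poly p) :
    Poly fun x => nameCheck (F x) (mem x) (prec x) (p x) :=
  hF.all (p := fun x (u : Fact) => !decide (u = .role (p x) u.src u.tgt) ||
      DLLite.pairCheck (F x) (mem x) (prec x) u.src u.tgt) <|
  (id.snd.eq ((hr.comp id.fst).role id.snd.src id.snd.tgt)).not.or <|
  (hF.comp id.fst).pairCheck (hm.comp id.fst) (hp.comp id.fst) id.snd.src id.snd.tgt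

theorem invCheck {p : α → ℕ} (hF : Poly F) (hm : Poly mem) (hp : Poly prec) (hr : Poly p) :
    Poly fun x => invCheck (F x) (mem x) (prec x) (p x) :=
  hF.all (p := fun x (u : Fact) => !decide (u = .role (p x) u.src u.tgt) ||
      DLLite.pairCheck (F x) (mem x) (prec x) u.tgt u.src) <|
  (id.snd.eq ((hr.comp id.fst).role id.snd.src id.snd.tgt)).not.or <|
  (hF.comp id.fst).pairCheck (hm.comp id.fst) (hp.comp id.fst) id.snd.tgt id.snd.src

end

theorem decideAdmissible : Poly DLLite.decideAdmissible := by
  -- The saturation is not part of the accumulator; each step recomputes it from the whole word, at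
  -- polynomial cost.
  have hF : Poly fun y : List Sym × Item × (List ℕ × List (ℕ × ℕ) × Bool) =>
      DLLite.saturate (DLLite.parse y.1) := saturate.comp (parse.comp id.fst)
  have hit : Poly fun y : List Sym × Item × (List ℕ × List (ℕ × ℕ) × Bool) => y.2.1 := id.snd.fst
  have hst : Poly fun y : List Sym × Item × (List ℕ × List (ℕ × ℕ) × Bool) => y.2.2 := id.snd.snd
  have hstep : Poly fun y : List Sym × Item × (List ℕ × List (ℕ × ℕ) × Bool) =>
      constraintStep (DLLite.saturate (DLLite.parse y.1)) y.2.2 y.2.1 :=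
    (hit.hasTag _).ite (hst.fst.pair (((hit.itemFst.pair hit.itemSnd).cons hst.snd.fst).pair
      hst.snd.snd)) <|
    (hit.hasTag _).ite ((hit.itemFst.cons hst.fst).pair hst.snd) <|
    (hit.hasTag _).ite ((const []).pair ((const []).pair
      ((hF.nameCheck hst.fst hst.snd.fst hit.itemFst).and hst.snd.snd))) <|
    (hit.hasTag _).ite ((const []).pair ((const []).pair
      ((hF.invCheck hst.fst hst.snd.fst hit.itemFst).and hst.snd.snd))) hst
  -- The factor 2 is due to `ordPrec` items, which add two names, each smaller than the item.
  refine (foldl_of_linear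
    (step := fun w => constraintStep (DLLite.saturate (DLLite.parse w)))
    parse.reverse (const ([], [], true)) hstep 2 fun w s it => ?_).snd.snd
  obtain ⟨mem, prec, ok⟩ := s
  have h₁ := size_pos it
  have h₂ : size it.fst + 2 ≤ size it := by
    have := size_le_size_of_headD it.2
    have := size_pos it.1
    have : size it = size it.1 + size it.2 + 1 := size_pair it.1 it.2
    have : size it.fst ≤ size it.2 := size_le_size_of_headD it.2
    omega
  have h₃ : size it.snd + 2 ≤ size it := by
    have := size_pos it.1
    have : size it = size it.1 + size it.2 + 1 := size_pair it.1 it.2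
    have : size it.snd ≤ size it.2.tail := size_le_size_of_headD it.2.tail
    have := size_le_of_sublist it.2.tail_sublist
    omega
  have h₄ := size_bool_le (DLLite.nameCheck (DLLite.saturate (DLLite.parse w)) mem prec it.fst && ok)
  have h₅ := size_bool_le (DLLite.invCheck (DLLite.saturate (DLLite.parse w)) mem prec it.fst && ok)
  have h₆ := size_pos mem
  have h₇ := size_pos prec
  have h₈ := size_pos ok
  unfold constraintStep
  cases decide (it.1 = .ordPrec) <;> cases decide (it.1 = .ordMember) <;>
    cases decide (it.1 = .ordName) <;> cases decide (it.1 = .ordInv) <;>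
    simp only [cond_true, cond_false, size_pair, size_cons, size_nil] <;> omega

end StackProgram.Poly

/-! ### Correctness of the decision procedure -/

namespace DLLite

/-- The item of a TBox axiom. -/
def TAxiom.item : TAxiom → Item
  | .subConcept A A' => (.subConcept, [A, A'])
  | .subExists A p => (.subExists, [A, p])
  | .existsSub p A => (.existsSub, [p, A])
  | .subRole p s => (.subRole, [p, s])
  | .subInverse p s => (.subInverse, [p, s])
  | .disjConcept A A' => (.disjConcept, [A, A'])
  | .disjRole p p' => (.disjRole, [p, p'])
  | .cri r s t => (.cri, [r, s, t])

/-- The item of an assertion. -/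
def Assertion.item : Assertion → Item
  | .concept A a => (.assertConcept, [A, a])
  | .role p a b => (.assertRole, [p, a, b])

/-- The item that starts an order constraint on a role. -/
def Role.item : Role → Item
  | .name p => (.ordName, [p])
  | .inv p => (.ordInv, [p])

/-- The items of an order constraint. -/
def OrderConstraint.items (c : OrderConstraint) : List Item :=
  c.role.item :: (c.concepts.map (fun A => (.ordMember, [A])) ++
    c.prec.map fun P => (.ordPrec, [P.1, P.2]))

/-- The items of an input. -/
def Input.items (I : Input) : List Item :=
  I.tbox.map TAxiom.item ++ I.abox.map Assertion.item ++ I.constraints.flatMap OrderConstraint.items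

/-- The string of an item. -/
def encodeItem (it : Item) : List Sym := it.1 :: it.2.flatMap encodeName

/-- Every part of the input is a keyword followed by names, and an order constraint is a series of
such items, so one uniform parser suffices. -/
theorem encodeInput_eq (I : Input) : encodeInput I = I.items.flatMap encodeItem := by
  have h₁ : encodeAxiom = fun τ => encodeItem τ.item := by
    funext τ; cases τ <;> simp [encodeAxiom, TAxiom.item, encodeItem]
  have h₂ : encodeAssertion = fun α => encodeItem α.item := by
    funext α; cases α <;> simp [encodeAssertion, Assertion.item, encodeItem]
  have h₃ : encodeConstraint = fun c => c.items.flatMap encodeItem := by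
    funext c
    have : encodeRole c.role = encodeItem c.role.item := by
      cases c.role <;> simp [encodeRole, Role.item, encodeItem]
    simp [encodeConstraint, OrderConstraint.items, this, List.flatMap_map, encodeItem]
  simp only [encodeInput, Input.items, List.flatMap_append, List.flatMap_map, List.flatMap_assoc,
    h₁, h₂, h₃]

/-! #### Parsing -/

/-- A symbol that starts an item. -/
def Sym.IsKeyword (s : Sym) : Prop := s ≠ .bit false ∧ s ≠ .bit true ∧ s ≠ .arg

theorem parse_encodeName (n : ℕ) (ws : List ℕ) (its : List Item) :
    (encodeName n).foldr (fun s st => parseStep st s) (0, ws, its) = (0, n :: ws, its) := by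
  have key : ∀ (l : List Bool), (l.map Sym.bit).foldr (fun s st => parseStep st s) (0, ws, its) =
      (l.foldr Nat.bit 0, ws, its) := by
    intro l
    induction l with
    | nil => rfl
    | cons b l ih =>
      rw [List.map_cons, List.foldr_cons, ih]
      cases b <;> simp [parseStep]
  rw [encodeName, List.foldr_cons, key, StackProgram.foldr_bit_encodeNat]
  simp [parseStep]

theorem parse_encodeItem (it : Item) (h : it.1.IsKeyword) (its : List Item) :
    (encodeItem it).foldr (fun s st => parseStep st s) (0, [], its) = (0, [], it :: its) := by
  have key : ∀ ns : List ℕ, (ns.flatMap encodeName).foldr (fun s st => parseStep st s)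
      (0, [], its) = (0, ns, its) := by
    intro ns
    induction ns with
    | nil => rfl
    | cons n ns ih => rw [List.flatMap_cons, List.foldr_append, ih, parse_encodeName]
  rw [encodeItem, List.foldr_cons, key]
  simp [parseStep, h.1, h.2.1, h.2.2]

theorem parse_encodeItems (its : List Item) (h : ∀ it ∈ its, it.1.IsKeyword) :
    parse (its.flatMap encodeItem).reverse = its := by
  have key : (its.flatMap encodeItem).foldr (fun s st => parseStep st s) (0, [], []) =
      (0, [], its) := by
    induction its with
    | nil => rfl
    | cons it its ih =>
      rw [List.flatMap_cons, List.foldr_append, ih fun it' h' => h it' (List.mem_cons_of_mem _ h'),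
        parse_encodeItem it (h it (by simp))]
  rw [parse, List.foldl_reverse, key]

theorem Input.mem_items {I : Input} {it : Item} : it ∈ I.items ↔
    (∃ τ ∈ I.tbox, τ.item = it) ∨ (∃ α ∈ I.abox, α.item = it) ∨
      ∃ c ∈ I.constraints, it ∈ c.items := by
  simp [Input.items]

theorem OrderConstraint.tag_of_mem_items {c : OrderConstraint} {it : Item} (h : it ∈ c.items) :
    it.1 = .ordName ∨ it.1 = .ordInv ∨ it.1 = .ordMember ∨ it.1 = .ordPrec := by
  simp only [items, List.mem_cons, List.mem_append, List.mem_map] at h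
  rcases h with rfl | ⟨A, _, rfl⟩ | ⟨P, _, rfl⟩
  · cases c.role <;> simp [Role.item]
  · simp
  · simp

theorem parse_encodeInput (I : Input) : parse (encodeInput I).reverse = I.items := by
  rw [encodeInput_eq]
  refine parse_encodeItems _ fun it h => ?_
  rcases Input.mem_items.1 h with ⟨τ, _, rfl⟩ | ⟨α, _, rfl⟩ | ⟨c, _, h⟩
  · cases τ <;> simp [TAxiom.item, Sym.IsKeyword]
  · cases α <;> simp [Assertion.item, Sym.IsKeyword]
  · rcases OrderConstraint.tag_of_mem_items h with h | h | h | h <;> simp [h, Sym.IsKeyword]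

/-! #### Saturation -/

theorem derivable_iff {its : List Item} {F : List Fact} {u : Fact} :
    derivable its F u = true ↔ (∃ it ∈ its, it.asserts u = true) ∨
      ∃ it ∈ its, ∃ φ ∈ F, ∃ ψ ∈ F, it.derives φ ψ u = true := by
  simp [derivable]

theorem derivable_mono {its : List Item} {F G : List Fact} (h : F ⊆ G) {u : Fact}
    (hu : derivable its F u = true) : derivable its G u = true := by
  rw [derivable_iff] at hu ⊢
  refine hu.imp_right ?_
  rintro ⟨it, hit, φ, hφ, ψ, hψ, hd⟩
  exact ⟨it, hit, φ, h hφ, ψ, h hψ, hd⟩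

/-- Iterations of a monotone operator on the sublists of a list reach a fixed point. -/
theorem filter_iterate_stable {α : Type} (U : List α) (D : List α → α → Bool)
    (hD : ∀ F G, F ⊆ G → ∀ u, D F u = true → D G u = true) :
    U.filter (D ((fun F => U.filter (D F))^[U.length] [])) =
      (fun F => U.filter (D F))^[U.length] [] := by
  set Φ : List α → List α := fun F => U.filter (D F) with hΦ
  change Φ (Φ^[U.length] []) = _
  have hsucc : ∀ n, Φ^[n + 1] [] = Φ (Φ^[n] []) := fun n => Function.iterate_succ_apply' Φ n []
  have hmono : ∀ n, (Φ^[n] []).Sublist (Φ^[n + 1] []) := by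
    intro n
    induction n with
    | zero => exact List.nil_sublist _
    | succ n ih =>
      rw [hsucc (n + 1), hsucc n]
      rw [hsucc n] at ih
      exact List.monotone_filter_right U fun u => hD _ _ ih.subset u
  have hsub : ∀ n, (Φ^[n] []).Sublist U := by
    intro n
    cases n with
    | zero => exact List.nil_sublist _
    | succ n => rw [hsucc]; exact List.filter_sublist
  -- The stages grow, so each stage that differs from the previous one is strictly longer; once two
  -- consecutive stages agree, all later ones do.
  have key : ∀ n, n ≤ (Φ^[n] []).length ∨ Φ^[n + 1] [] = Φ^[n] [] := by
    intro n
    induction n with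
    | zero => exact .inl (Nat.zero_le _)
    | succ n ih =>
      rcases ih with ih | ih
      · rcases (hmono n).length_le.eq_or_lt with h | h
        · right
          rw [hsucc (n + 1), ← (hmono n).eq_of_length h, ← hsucc, ← (hmono n).eq_of_length h]
        · left; omega
      · right
        rw [hsucc (n + 1), ih, ← hsucc, ih]
  rw [← hsucc]
  rcases key U.length with h | h
  -- A sublist of `U` as long as `U` is `U`, and the next stage lies between the two.
  · have h₁ := (hsub U.length).eq_of_length (le_antisymm (hsub _).length_le h)
    have h₂ := hmono U.length
    rw [h₁] at h₂ ⊢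
    exact (hsub _).antisymm h₂
  · exact h

theorem saturate_eq (its : List Item) : saturate its =
    (fun F => (allFacts its).filter (derivable its F))^[(allFacts its).length] [] := by
  have key : ∀ {α β : Type} (f : β → β) (l : List α) (s : β),
      l.foldl (fun s _ => f s) s = f^[l.length] s := by
    intro α β f l
    induction l with
    | nil => intro s; rfl
    | cons a l ih => intro s; rw [List.foldl_cons, ih, List.length_cons, Function.iterate_succ_apply]
  exact key _ _ _

theorem mem_saturate_of_derivable {its : List Item} {u : Fact} (hu : u ∈ allFacts its)
    (hd : derivable its (saturate its) u = true) : u ∈ saturate its := by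
  have h := filter_iterate_stable (allFacts its) (derivable its) fun F G h u => derivable_mono h
  rw [← saturate_eq] at h
  rw [← h]
  exact List.mem_filter.2 ⟨hu, hd⟩

theorem mem_allElems {its : List Item} {d : Elem} : d ∈ allElems its ↔ match d with
    | .ind a => a ∈ itemNames its
    | .filler a r => a ∈ itemNames its ∧ r ∈ itemNames its
    | .shared r => r ∈ itemNames its := by
  cases d <;> simp [allElems]

theorem mem_allFacts {its : List Item} {u : Fact} : u ∈ allFacts its ↔ match u with
    | .concept A d => A ∈ itemNames its ∧ d ∈ allElems its
    | .role r d e => r ∈ itemNames its ∧ d ∈ allElems its ∧ e ∈ allElems its := by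
  cases u <;> simp [allFacts]

section

variable {I : Input}

theorem mem_itemNames_axiom {τ : TAxiom} (hτ : τ ∈ I.tbox) {n : ℕ} (hn : n ∈ τ.item.2) :
    n ∈ itemNames I.items :=
  List.mem_flatMap.2 ⟨τ.item, Input.mem_items.2 (.inl ⟨τ, hτ, rfl⟩), hn⟩

theorem mem_itemNames_assertion {α : Assertion} (hα : α ∈ I.abox) {n : ℕ} (hn : n ∈ α.item.2) :
    n ∈ itemNames I.items :=
  List.mem_flatMap.2 ⟨α.item, Input.mem_items.2 (.inr (.inl ⟨α, hα, rfl⟩)), hn⟩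

/-- No rule invents names: the fillers, too, are built from names of the input. Restricting the
saturation to candidates therefore loses nothing. -/
theorem SmallFact.mem_allFacts {u : Fact} (h : SmallFact I.tbox I.abox u) :
    u ∈ allFacts I.items := by
  induction h with
  | aboxConcept h =>
    exact DLLite.mem_allFacts.2 ⟨mem_itemNames_assertion h (by simp [Assertion.item]),
      mem_allElems.2 (mem_itemNames_assertion h (by simp [Assertion.item]))⟩
  | aboxRole h =>
    exact DLLite.mem_allFacts.2 ⟨mem_itemNames_assertion h (by simp [Assertion.item]),
      mem_allElems.2 (mem_itemNames_assertion h (by simp [Assertion.item])),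
      mem_allElems.2 (mem_itemNames_assertion h (by simp [Assertion.item]))⟩
  | existsInd h _ ih =>
    have hr := mem_itemNames_axiom h (n := _) (List.mem_cons_of_mem _ (List.mem_singleton_self _))
    have hd := (DLLite.mem_allFacts.1 ih).2
    exact DLLite.mem_allFacts.2 ⟨hr, hd, mem_allElems.2 ⟨mem_allElems.1 hd, hr⟩⟩
  | existsFiller h _ ih =>
    have hr := mem_itemNames_axiom h (n := _) (List.mem_cons_of_mem _ (List.mem_singleton_self _))
    exact DLLite.mem_allFacts.2 ⟨hr, (DLLite.mem_allFacts.1 ih).2, mem_allElems.2 hr⟩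
  | existsShared h _ ih =>
    have hr := mem_itemNames_axiom h (n := _) (List.mem_cons_of_mem _ (List.mem_singleton_self _))
    exact DLLite.mem_allFacts.2 ⟨hr, (DLLite.mem_allFacts.1 ih).2, mem_allElems.2 hr⟩
  | subConcept h _ ih =>
    exact DLLite.mem_allFacts.2 ⟨mem_itemNames_axiom h (by simp [TAxiom.item]),
      (DLLite.mem_allFacts.1 ih).2⟩
  | existsSub h _ ih =>
    exact DLLite.mem_allFacts.2 ⟨mem_itemNames_axiom h (by simp [TAxiom.item]),
      (DLLite.mem_allFacts.1 ih).2.1⟩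
  | subRole h _ ih =>
    exact DLLite.mem_allFacts.2 ⟨mem_itemNames_axiom h (by simp [TAxiom.item]),
      (DLLite.mem_allFacts.1 ih).2⟩
  | subInverse h _ ih =>
    exact DLLite.mem_allFacts.2 ⟨mem_itemNames_axiom h (by simp [TAxiom.item]),
      (DLLite.mem_allFacts.1 ih).2.symm⟩
  | cri h _ _ ih₁ ih₂ =>
    exact DLLite.mem_allFacts.2 ⟨mem_itemNames_axiom h (by simp [TAxiom.item]),
      (DLLite.mem_allFacts.1 ih₁).2.1, (DLLite.mem_allFacts.1 ih₂).2.2⟩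

theorem smallFact_of_asserts {it : Item} (hit : it ∈ I.items) {u : Fact}
    (h : it.asserts u = true) : SmallFact I.tbox I.abox u := by
  rcases Input.mem_items.1 hit with ⟨τ, _, rfl⟩ | ⟨α, hα, rfl⟩ | ⟨c, _, hc⟩
  · cases τ <;> simp [Item.asserts, TAxiom.item] at h
  · cases α with
    | concept A a =>
      obtain rfl : u = _ := by
        simpa [Item.asserts, Assertion.item, Item.fst, Item.snd] using h
      exact .aboxConcept hα
    | role p a b =>
      obtain rfl : u = _ := by
        simpa [Item.asserts, Assertion.item, Item.fst, Item.snd, Item.thd] using h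
      exact .aboxRole hα
  · rcases OrderConstraint.tag_of_mem_items hc with h' | h' | h' | h' <;>
      simp [Item.asserts, h'] at h

theorem smallFact_of_derives {it : Item} (hit : it ∈ I.items) {φ ψ u : Fact}
    (hφ : SmallFact I.tbox I.abox φ) (hψ : SmallFact I.tbox I.abox ψ)
    (h : it.derives φ ψ u = true) : SmallFact I.tbox I.abox u := by
  simp only [Item.derives, Bool.or_eq_true, Bool.and_eq_true, decide_eq_true_eq] at h
  rcases Input.mem_items.1 hit with ⟨τ, hτ, rfl⟩ | ⟨α, _, rfl⟩ | ⟨c, _, hc⟩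
  · cases τ <;> simp only [TAxiom.item, Item.fst, Item.snd, Item.thd,
      List.headD_cons, List.tail_cons, reduceCtorEq, false_and, or_false, false_or, true_and] at h
    · obtain ⟨h₁, rfl⟩ := h
      exact .subConcept hτ (h₁ ▸ hφ)
    · obtain ⟨h₁, rfl⟩ := h
      rw [h₁] at hφ
      -- `Elem.next` merges the three existential rules; the kind of the source element selects the
      -- rule.
      cases hd : φ.src with
      | ind a => rw [hd] at hφ; exact .existsInd hτ hφ
      | filler a r => rw [hd] at hφ; exact .existsFiller hτ hφ
      | shared r => rw [hd] at hφ; exact .existsShared hτ hφ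
    · obtain ⟨h₁, rfl⟩ := h
      exact .existsSub hτ (h₁ ▸ hφ)
    · obtain ⟨h₁, rfl⟩ := h
      exact .subRole hτ (h₁ ▸ hφ)
    · obtain ⟨h₁, rfl⟩ := h
      exact .subInverse hτ (h₁ ▸ hφ)
    · obtain ⟨h₁, h₂, rfl⟩ := h
      exact .cri hτ (h₁ ▸ hφ) (h₂ ▸ hψ)
  · cases α <;> simp [Assertion.item] at h
  · rcases OrderConstraint.tag_of_mem_items hc with h' | h' | h' | h' <;>
      simp [h'] at h

theorem mem_saturate_of_axiom {τ : TAxiom} (hτ : τ ∈ I.tbox) {φ ψ u : Fact}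
    (hu : SmallFact I.tbox I.abox u) (hφ : φ ∈ saturate I.items) (hψ : ψ ∈ saturate I.items)
    (h : τ.item.derives φ ψ u = true) : u ∈ saturate I.items :=
  mem_saturate_of_derivable hu.mem_allFacts (derivable_iff.2 (.inr ⟨τ.item,
    Input.mem_items.2 (.inl ⟨τ, hτ, rfl⟩), φ, hφ, ψ, hψ, h⟩))

theorem mem_saturate_of_assertion {α : Assertion} (hα : α ∈ I.abox) {u : Fact}
    (hu : SmallFact I.tbox I.abox u) (h : α.item.asserts u = true) : u ∈ saturate I.items :=
  mem_saturate_of_derivable hu.mem_allFacts (derivable_iff.2 (.inl ⟨α.item,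
    Input.mem_items.2 (.inr (.inl ⟨α, hα, rfl⟩)), h⟩))

/-- Soundness is by induction on the rounds. Completeness is by induction on the derivation, as the
saturation is a fixed point and all derivable facts are candidates. -/
theorem mem_saturate_iff {u : Fact} :
    u ∈ saturate I.items ↔ SmallFact I.tbox I.abox u := by
  constructor
  · rw [saturate_eq]
    generalize (allFacts I.items).length = n
    induction n generalizing u with
    | zero => intro h; simp at h
    | succ n ih =>
      intro h
      rw [Function.iterate_succ_apply'] at h
      rcases derivable_iff.1 (List.mem_filter.1 h).2 with ⟨it, hit, hu⟩ |
        ⟨it, hit, φ, hφ, ψ, hψ, hu⟩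
      · exact smallFact_of_asserts hit hu
      · exact smallFact_of_derives hit (ih hφ) (ih hψ) hu
  · intro h
    induction h with
    | aboxConcept h =>
      exact mem_saturate_of_assertion h (.aboxConcept h)
        (by simp [Item.asserts, Assertion.item, Item.fst, Item.snd])
    | aboxRole h =>
      exact mem_saturate_of_assertion h (.aboxRole h)
        (by simp [Item.asserts, Assertion.item, Item.fst, Item.snd, Item.thd])
    | existsInd h h' ih =>
      -- `derives` ignores the second premise for all axioms but CRIs, so the first one is supplied
      -- twice.
      exact mem_saturate_of_axiom h (.existsInd h h') ih ih
        (by simp [Item.derives, TAxiom.item, Item.fst, Item.snd, Fact.src, Elem.next])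
    | existsFiller h h' ih =>
      exact mem_saturate_of_axiom h (.existsFiller h h') ih ih
        (by simp [Item.derives, TAxiom.item, Item.fst, Item.snd, Fact.src, Elem.next])
    | existsShared h h' ih =>
      exact mem_saturate_of_axiom h (.existsShared h h') ih ih
        (by simp [Item.derives, TAxiom.item, Item.fst, Item.snd, Fact.src, Elem.next])
    | subConcept h h' ih =>
      exact mem_saturate_of_axiom h (.subConcept h h') ih ih
        (by simp [Item.derives, TAxiom.item, Item.fst, Item.snd, Fact.src])
    | existsSub h h' ih =>
      exact mem_saturate_of_axiom h (.existsSub h h') ih ih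
        (by simp [Item.derives, TAxiom.item, Item.fst, Item.snd, Fact.src, Fact.tgt])
    | subRole h h' ih =>
      exact mem_saturate_of_axiom h (.subRole h h') ih ih
        (by simp [Item.derives, TAxiom.item, Item.fst, Item.snd, Fact.src, Fact.tgt])
    | subInverse h h' ih =>
      exact mem_saturate_of_axiom h (.subInverse h h') ih ih
        (by simp [Item.derives, TAxiom.item, Item.fst, Item.snd, Fact.src, Fact.tgt])
    | cri h h₁ h₂ ih₁ ih₂ =>
      exact mem_saturate_of_axiom h (.cri h h₁ h₂) ih₁ ih₂
        (by simp [Item.derives, TAxiom.item, Item.fst, Item.snd, Item.thd, Fact.src, Fact.tgt])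

end

/-! #### Order constraints -/

/-- All elements of a fact belong to the domain of the small model. -/
theorem SmallFact.mem_smallDomain {𝒯 : TBox} {𝒜 : ABox} {u : Fact} (h : SmallFact 𝒯 𝒜 u) :
    u.src ∈ smallDomain 𝒯 𝒜 ∧ u.tgt ∈ smallDomain 𝒯 𝒜 := by
  induction h with
  | @aboxConcept A a h =>
    have : a ∈ ABox.inds 𝒜 := ⟨_, h, rfl⟩
    exact ⟨this, this⟩
  | @aboxRole p a b h => exact ⟨⟨_, h, .inl rfl⟩, ⟨_, h, .inr rfl⟩⟩
  | existsInd h _ ih => exact ⟨ih.1, ih.1, _, h⟩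
  | existsFiller h _ ih => exact ⟨ih.1, _, h⟩
  | existsShared h _ ih => exact ⟨ih.1, _, h⟩
  | subConcept _ _ ih => exact ih
  | existsSub _ _ ih => exact ⟨ih.1, ih.1⟩
  | subRole _ _ ih => exact ih
  | subInverse _ _ ih => exact ih.symm
  | cri _ _ _ ih₁ ih₂ => exact ⟨ih₁.1, ih₂.2⟩

/-- The condition of an order constraint on a pair of elements of an interpretation. -/
def OrderConstraint.Holds (c : OrderConstraint) (ℐ : Interpretation) (d e : ℐ.Δ) : Prop :=
  (∃ A ∈ c.concepts, d ∈ ℐ.concept A) ∧ (∃ A ∈ c.concepts, e ∈ ℐ.concept A) ∧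
    ∀ A ∈ c.concepts, ∀ B ∈ c.concepts, d ∈ ℐ.concept A → e ∈ ℐ.concept B → (A, B) ∈ c.prec

/-- The common pointwise form to which both the query check and the decision procedure are reduced.
-/
theorem satisfiesOrder_iff (ℐ : Interpretation) (c : OrderConstraint) :
    ℐ.SatisfiesOrder c ↔ ∀ d e, (d, e) ∈ ℐ.roleExt c.role → c.Holds ℐ d e := by
  simp only [Interpretation.SatisfiesOrder, Set.subset_def, Set.eq_empty_iff_forall_notMem,
    Set.mem_inter_iff, Set.mem_iUnion, Set.mem_prod, exists_prop, OrderConstraint.Holds,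
    Prod.forall]
  constructor
  · rintro ⟨h₁, h₂⟩ d e hde
    obtain ⟨A, hA, B, hB, hd, he⟩ := h₁ d e hde
    refine ⟨⟨A, hA, hd⟩, ⟨B, hB, he⟩, fun A' hA' B' hB' hd' he' => ?_⟩
    by_contra hp
    exact h₂ d e ⟨hde, A', hA', B', hB', hp, hd', he'⟩
  · intro h
    refine ⟨fun d e hde => ?_, ?_⟩
    · obtain ⟨⟨A, hA, hd⟩, ⟨B, hB, he⟩, _⟩ := h d e hde
      exact ⟨A, hA, B, hB, hd, he⟩
    · rintro d e ⟨hde, A, hA, B, hB, hp, hd, he⟩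
      exact hp ((h d e hde).2.2 A hA B hB hd he)

theorem pairCheck_iff {I : Input} (c : OrderConstraint)
    (d e : (smallModel I.tbox I.abox).Δ) :
    pairCheck (saturate I.items) c.concepts c.prec d.1 e.1 = true ↔
      c.Holds (smallModel I.tbox I.abox) d e := by
  simp only [pairCheck, OrderConstraint.Holds, Bool.and_eq_true, List.any_eq_true,
    List.all_eq_true, decide_eq_true_eq, mem_saturate_iff, Bool.or_eq_true, Bool.not_eq_true',
    Bool.and_eq_false_imp, decide_eq_false_iff_not]
  refine and_congr Iff.rfl (and_congr Iff.rfl (forall₂_congr fun A hA => forall₂_congr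
    fun B hB => ?_))
  change _ ↔ (SmallFact I.tbox I.abox (.concept A d.1) → SmallFact I.tbox I.abox (.concept B e.1) →
    (A, B) ∈ c.prec)
  tauto

/-- The check of an order constraint. -/
def OrderConstraint.check (F : List Fact) (c : OrderConstraint) : Bool :=
  match c.role with
  | .name p => nameCheck F c.concepts c.prec p
  | .inv p => invCheck F c.concepts c.prec p

theorem check_iff (I : Input) (c : OrderConstraint) :
    c.check (saturate I.items) = true ↔ (smallModel I.tbox I.abox).SatisfiesOrder c := by
  rw [satisfiesOrder_iff, OrderConstraint.check]
  rcases hc : c.role with p | p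
  · simp only [nameCheck, List.all_eq_true, mem_saturate_iff, Bool.or_eq_true, Bool.not_eq_true',
      decide_eq_false_iff_not]
    constructor
    · intro h d e hde
      exact (pairCheck_iff c d e).1 ((h (.role p d.1 e.1) hde).resolve_left (by simp [Fact.src,
        Fact.tgt]))
    · intro h u hu
      refine or_iff_not_imp_left.2 fun hur => ?_
      -- The saturation lists facts about bare elements; this lifts their ends to the domain of the
      -- model.
      have hdom := hu.mem_smallDomain
      rw [not_not.1 hur] at hu
      exact (pairCheck_iff c ⟨u.src, hdom.1⟩ ⟨u.tgt, hdom.2⟩).2 (h _ _ hu)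
  · simp only [invCheck, List.all_eq_true, mem_saturate_iff, Bool.or_eq_true, Bool.not_eq_true',
      decide_eq_false_iff_not]
    constructor
    · intro h d e hde
      exact (pairCheck_iff c d e).1 ((h (.role p e.1 d.1) hde).resolve_left (by simp [Fact.src,
        Fact.tgt]))
    · intro h u hu
      refine or_iff_not_imp_left.2 fun hur => ?_
      have hdom := hu.mem_smallDomain
      rw [not_not.1 hur] at hu
      exact (pairCheck_iff c ⟨u.tgt, hdom.2⟩ ⟨u.src, hdom.1⟩).2 (h _ _ hu)

/-- Read from right to left, the pairs and the concepts of a constraint come before its role item,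
which triggers the check and resets the state for the next constraint. -/
theorem constraintStep_items (F : List Fact) (c : OrderConstraint) (ok : Bool) :
    c.items.foldr (fun it st => constraintStep F st it) ([], [], ok) =
      ([], [], c.check F && ok) := by
  have h₁ : ∀ l : List (ℕ × ℕ), (l.map fun P => ((Sym.ordPrec, [P.1, P.2]) : Item)).foldr
      (fun it st => constraintStep F st it) ([], [], ok) = ([], l, ok) := by
    intro l
    induction l with
    | nil => rfl
    | cons P l ih =>
      rw [List.map_cons, List.foldr_cons, ih]
      simp [constraintStep, Item.fst, Item.snd]
  have h₂ : ∀ l : List ℕ, (l.map fun A => ((Sym.ordMember, [A]) : Item)).foldr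
      (fun it st => constraintStep F st it) ([], c.prec, ok) = (l, c.prec, ok) := by
    intro l
    induction l with
    | nil => rfl
    | cons A l ih =>
      rw [List.map_cons, List.foldr_cons, ih]
      simp [constraintStep, Item.fst]
  rw [OrderConstraint.items, List.foldr_cons, List.foldr_append, h₁, h₂, OrderConstraint.check]
  cases c.role <;> simp [constraintStep, Role.item, Item.fst]

theorem decideAdmissible_encodeInput (I : Input) :
    decideAdmissible (encodeInput I).reverse = true ↔ CAdmissible I.tbox I.abox I.constraints := by
  rw [decideAdmissible, parse_encodeInput, List.foldl_reverse]
  generalize hF : saturate I.items = F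
  have h₁ : ∀ cs : List OrderConstraint, (cs.flatMap OrderConstraint.items).foldr
      (fun it st => constraintStep F st it) ([], [], true) =
      ([], [], cs.all fun c => c.check F) := by
    intro cs
    induction cs with
    | nil => rfl
    | cons c cs ih =>
      rw [List.flatMap_cons, List.foldr_append, ih, constraintStep_items, List.all_cons]
  -- Axioms and assertions leave the state of the constraint check untouched.
  have h₂ : ∀ (l : List Item) (st : List ℕ × List (ℕ × ℕ) × Bool),
      (∀ it ∈ l, (∃ τ : TAxiom, τ.item = it) ∨ ∃ α : Assertion, α.item = it) →
      l.foldr (fun it st => constraintStep F st it) st = st := by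
    intro l st h
    induction l with
    | nil => rfl
    | cons it l ih =>
      rw [List.foldr_cons, ih fun it' h' => h it' (List.mem_cons_of_mem _ h')]
      rcases h it (by simp) with ⟨τ, rfl⟩ | ⟨α, rfl⟩
      · cases τ <;> simp [constraintStep, TAxiom.item]
      · cases α <;> simp [constraintStep, Assertion.item]
  rw [Input.items, List.foldr_append, h₁, h₂]
  · simp only [List.all_eq_true, ← hF, check_iff]
    rfl
  · intro it hit
    rcases List.mem_append.1 hit with h | h
    · obtain ⟨τ, _, rfl⟩ := List.mem_map.1 h
      exact .inl ⟨τ, rfl⟩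
    · obtain ⟨α, _, rfl⟩ := List.mem_map.1 h
      exact .inr ⟨α, rfl⟩

/-! ### The admissibility check by queries -/

theorem satisfiesAtom_roleAtom (ℐ : Interpretation) (r : Role) (π : ℕ → ℐ.Δ) (x y : ℕ) :
    ℐ.SatisfiesAtom π (r.atom x y) ↔ (π x, π y) ∈ ℐ.roleExt r := by
  cases r <;> rfl

theorem mem_ans_query₁ (ℐ : Interpretation) (c : OrderConstraint) (a : Fin 2 → ℐ.Δ) :
    a ∈ (query₁ c).ans ℐ ↔ (a 0, a 1) ∈ ℐ.roleExt c.role := by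
  constructor
  · rintro ⟨π, hπ, hb⟩
    have := (satisfiesAtom_roleAtom ℐ c.role π 0 1).1 (hb _ (by simp [query₁]))
    rwa [← hπ 0, ← hπ 1]
  · intro h
    -- Only the variables `0` and `1` occur; all others may go to any element, here `a 1`.
    refine ⟨fun n => if n = 0 then a 0 else a 1, fun i => by fin_cases i <;> rfl, ?_⟩
    intro α hα
    obtain rfl : α = c.role.atom 0 1 := by simpa [query₁] using hα
    rw [satisfiesAtom_roleAtom]
    exact h

theorem mem_ans_pairQuery (ℐ : Interpretation) (c : OrderConstraint)
    (P : ConceptName × ConceptName) (a : Fin 2 → ℐ.Δ) :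
    a ∈ (pairQuery c P).ans ℐ ↔
      (a 0, a 1) ∈ ℐ.roleExt c.role ∧ a 0 ∈ ℐ.concept P.1 ∧ a 1 ∈ ℐ.concept P.2 := by
  constructor
  · rintro ⟨π, hπ, hb⟩
    have h₁ := (satisfiesAtom_roleAtom ℐ c.role π 0 1).1 (hb _ (by simp [pairQuery]))
    have h₂ : π 0 ∈ ℐ.concept P.1 := hb (.concept P.1 0) (by simp [pairQuery])
    have h₃ : π 1 ∈ ℐ.concept P.2 := hb (.concept P.2 1) (by simp [pairQuery])
    rw [← hπ 0, ← hπ 1]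
    exact ⟨h₁, h₂, h₃⟩
  · rintro ⟨h₁, h₂, h₃⟩
    refine ⟨fun n => if n = 0 then a 0 else a 1, fun i => by fin_cases i <;> rfl, ?_⟩
    intro α hα
    simp only [pairQuery, List.mem_cons, List.not_mem_nil, or_false] at hα
    rcases hα with rfl | rfl | rfl
    · exact h₂
    · exact (satisfiesAtom_roleAtom ..).2 h₁
    · exact h₃

theorem mem_ansUnion_query₂ (ℐ : Interpretation) (c : OrderConstraint) (a : Fin 2 → ℐ.Δ) :
    a ∈ ansUnion (query₂ c) ℐ ↔ (a 0, a 1) ∈ ℐ.roleExt c.role ∧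
      ∃ A ∈ c.concepts, ∃ B ∈ c.concepts, (A, B) ∈ c.prec ∧
        a 0 ∈ ℐ.concept A ∧ a 1 ∈ ℐ.concept B := by
  simp only [ansUnion, query₂, Set.mem_iUnion, exists_prop, List.mem_map, List.mem_filter,
    decide_eq_true_eq]
  constructor
  · rintro ⟨_, ⟨P, ⟨hP, hp⟩, rfl⟩, h⟩
    obtain ⟨h, hd, he⟩ := (mem_ans_pairQuery ℐ c P a).1 h
    obtain ⟨hA, hB⟩ := List.mem_product.1 hP
    exact ⟨h, P.1, hA, P.2, hB, hp, hd, he⟩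
  · rintro ⟨h, A, hA, B, hB, hp, hd, he⟩
    exact ⟨_, ⟨(A, B), ⟨List.mem_product.2 ⟨hA, hB⟩, hp⟩, rfl⟩,
      (mem_ans_pairQuery ℐ c (A, B) a).2 ⟨h, hd, he⟩⟩

theorem mem_ansUnion_query₃ (ℐ : Interpretation) (c : OrderConstraint) (a : Fin 2 → ℐ.Δ) :
    a ∈ ansUnion (query₃ c) ℐ ↔ (a 0, a 1) ∈ ℐ.roleExt c.role ∧
      ∃ A ∈ c.concepts, ∃ B ∈ c.concepts, (A, B) ∉ c.prec ∧
        a 0 ∈ ℐ.concept A ∧ a 1 ∈ ℐ.concept B := by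
  simp only [ansUnion, query₃, Set.mem_iUnion, exists_prop, List.mem_map, List.mem_filter,
    decide_eq_true_eq]
  constructor
  · rintro ⟨_, ⟨P, ⟨hP, hp⟩, rfl⟩, h⟩
    obtain ⟨h, hd, he⟩ := (mem_ans_pairQuery ℐ c P a).1 h
    obtain ⟨hA, hB⟩ := List.mem_product.1 hP
    exact ⟨h, P.1, hA, P.2, hB, hp, hd, he⟩
  · rintro ⟨h, A, hA, B, hB, hp, hd, he⟩
    exact ⟨_, ⟨(A, B), ⟨List.mem_product.2 ⟨hA, hB⟩, hp⟩, rfl⟩,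
      (mem_ans_pairQuery ℐ c (A, B) a).2 ⟨h, hd, he⟩⟩

/-- Excluding answers of the third query forces `≺` between any listed concepts that contain the two
ends, so the restriction to `A₁ ≺ A₂` in the second query costs nothing. -/
theorem queries_iff_satisfiesOrder (ℐ : Interpretation) (c : OrderConstraint) :
    (query₁ c).ans ℐ ⊆ ansUnion (query₂ c) ℐ ∧
      (query₁ c).ans ℐ ∩ ansUnion (query₃ c) ℐ = ∅ ↔ ℐ.SatisfiesOrder c := by
  rw [satisfiesOrder_iff]
  constructor
  · rintro ⟨h₁, h₂⟩ d e hde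
    have hq : ![d, e] ∈ (query₁ c).ans ℐ := (mem_ans_query₁ ℐ c _).2 hde
    obtain ⟨_, A, hA, B, hB, _, hd, he⟩ := (mem_ansUnion_query₂ ℐ c _).1 (h₁ hq)
    refine ⟨⟨A, hA, hd⟩, ⟨B, hB, he⟩, fun A' hA' B' hB' hd' he' => ?_⟩
    by_contra hp
    exact Set.eq_empty_iff_forall_notMem.1 h₂ ![d, e]
      ⟨hq, (mem_ansUnion_query₃ ℐ c _).2 ⟨hde, A', hA', B', hB', hp, hd', he'⟩⟩
  · intro h
    refine ⟨fun a ha => ?_, Set.eq_empty_iff_forall_notMem.2 ?_⟩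
    · have hr := (mem_ans_query₁ ℐ c a).1 ha
      obtain ⟨⟨A, hA, hd⟩, ⟨B, hB, he⟩, hp⟩ := h _ _ hr
      exact (mem_ansUnion_query₂ ℐ c a).2 ⟨hr, A, hA, B, hB, hp A hA B hB hd he, hd, he⟩
    · rintro a ⟨_, ha⟩
      obtain ⟨hr, A, hA, B, hB, hp, hd, he⟩ := (mem_ansUnion_query₃ ℐ c a).1 ha
      exact hp ((h _ _ hr).2.2 A hA B hB hd he)

theorem checkAdmissibility_iff (ℐ : Interpretation) (𝒞 : List OrderConstraint) :
    checkAdmissibility ℐ 𝒞 = true ↔ ∀ c ∈ 𝒞, ℐ.SatisfiesOrder c := by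
  induction 𝒞 with
  | nil => simp [checkAdmissibility]
  | cons c 𝒞 ih =>
    rw [checkAdmissibility, List.forall_mem_cons, ← queries_iff_satisfiesOrder, ← ih]
    by_cases h₁ : (query₁ c).ans ℐ ⊆ ansUnion (query₂ c) ℐ
    · by_cases h₂ : (query₁ c).ans ℐ ∩ ansUnion (query₃ c) ℐ = ∅
      · simp [h₁, h₂]
      · simp [h₁, h₂]
    · simp [h₁]

end DLLite

theorem mainTheorem12 (NRs : Set DLLite.Role)
    (hNRs : ∀ s ∈ NRs, s.inverse ∈ NRs) :
    (∀ I : {I : DLLite.Input // I.Valid NRs},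
      DLLite.checkAdmissibility (DLLite.smallModel I.1.tbox I.1.abox) I.1.constraints = true ↔
        DLLite.CAdmissible I.1.tbox I.1.abox I.1.constraints) ∧
    ∃ f : {I : DLLite.Input // I.Valid NRs} → Bool,
      (∀ I, f I = true ↔ DLLite.CAdmissible I.1.tbox I.1.abox I.1.constraints) ∧
      Nonempty (Turing.TM2ComputableInPolyTime
        (fun I : {I : DLLite.Input // I.Valid NRs} => DLLite.encodeInput I.1)
        Computability.encodeBool f) :=
  ⟨fun _ => DLLite.checkAdmissibility_iff _ _,
    fun I => DLLite.decideAdmissible (DLLite.encodeInput I.1).reverse,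
    fun I => DLLite.decideAdmissible_encodeInput I.1,
    -- The decision function depends on the string alone, so it agrees by definition with the
    -- function on reversed words.
    StackProgram.nonempty_computableInPolyTime _ _ StackProgram.Poly.decideAdmissible
      fun _ => rfl⟩
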